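/- Let $n\ge 2$ be finite. An algebra of type $cyl_n$ has constants $0,1,d_{ij}$ ($i,j<n$), unary operations $-,c_i$ ($i<n$) and binary operations $\cdot,+$. Let $NCA_n$ be the class of all algebras of type $cyl_n$ that are Boolean algebras with respect to $+,\cdot,-,0,1$ and satisfy, for all $i,j,k<n$, $$c_i0=0,\qquad x\le c_ix,\qquad c_i(x\cdot c_iy)=c_ix\cdot c_iy,\qquad d_{ii}=1,$$ $$c_i(d_{ij}\cdot x)\cdot c_i(d_{ij}\cdot -x)=0\quad\text{if } i\ne j,$$ $$d_{ij}=c_k(d_{ik}\cdot d_{kj})\quad\text{if } k\notin\{i,j\}.$$ Let $WCA_n$ be the class defined in the same way, except that the last equation is replaced by $$d_{ik}\cdot d_{kj}\le d_{ij}=d_{ji}=c_kd_{ji}\quad\text{if } k\notin\{i,j\}.$$ Let $K\in\{NCA_n,WCA_n\}$, and consider terms of type $cyl_n$ in the variables $x_0,x_1,x_2,\dots$. Then: 1. Every term that takes a nonzero value in some member of $K$, under some evaluation of the variables, takes a nonzero value in some finite member of $K$, under some evaluation of the variables. 2. $K$ is generated by its finite members, in the sense that the equational theory of $K$ (the set of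 all equations $s=t$ between such terms that are valid in every member of $K$) equals the equational theory of the class of finite members of $K$. 3. The equational theory of $K$ is decidable: there is an algorithm that decides, given (the Gödel numbers of) two terms $s,t$, whether the equation $s=t$ is valid in every member of $K$. -/

import Mathlib

universe u v

/-- Terms of the algebraic type `cyl_n` over the variables `x_0, x_1, x_2, …`. -/
inductive CylTerm (n : ℕ) : Type
  | var : ℕ → CylTerm n
  | zero : CylTerm n
  | one : CylTerm n
  | diag : Fin n → Fin n → CylTerm n
  | neg : CylTerm n → CylTerm n
  | cyl : Fin n → CylTerm n → CylTerm n
  | mul : CylTerm n → CylTerm n → CylTerm n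
  | add : CylTerm n → CylTerm n → CylTerm n

/-- The non-Boolean operations of an algebra of type `cyl_n` with universe `A`: the
cylindrifications `c_i` and the diagonal constants `d_ij`. -/
structure CylOps (n : ℕ) (A : Type u) where
  c : Fin n → A → A
  d : Fin n → Fin n → A

/-- The value of a term in the algebra `(A, C)` under the evaluation `e` of the variables. -/
def CylTerm.eval {n : ℕ} {A : Type u} [BooleanAlgebra A] (C : CylOps n A) (e : ℕ → A) :
    CylTerm n → A
  | .var k => e k
  | .zero => ⊥
  | .one => ⊤
  | .diag i j => C.d i j
  | .neg t => (t.eval C e)ᶜ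
  | .cyl i t => C.c i (t.eval C e)
  | .mul s t => s.eval C e ⊓ t.eval C e
  | .add s t => s.eval C e ⊔ t.eval C e

/-- The equations shared by both classes, apart from the Boolean ones. -/
structure CylOps.IsBase {n : ℕ} {A : Type u} [BooleanAlgebra A] (C : CylOps n A) : Prop where
  c_bot : ∀ i, C.c i ⊥ = ⊥
  le_c : ∀ i x, x ≤ C.c i x
  c_inf_c : ∀ i x y, C.c i (x ⊓ C.c i y) = C.c i x ⊓ C.c i y
  d_self : ∀ i, C.d i i = ⊤
  c_d_inf : ∀ i j, i ≠ j → ∀ x, C.c i (C.d i j ⊓ x) ⊓ C.c i (C.d i j ⊓ xᶜ) = ⊥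

/-- Non-commutative cylindric algebras of dimension `n`. -/
structure CylOps.IsNCA {n : ℕ} {A : Type u} [BooleanAlgebra A] (C : CylOps n A) : Prop
    extends C.IsBase where
  d_eq : ∀ i j k, k ≠ i → k ≠ j → C.d i j = C.c k (C.d i k ⊓ C.d k j)

/-- Weakened cylindric algebras of dimension `n`. -/
structure CylOps.IsWCA {n : ℕ} {A : Type u} [BooleanAlgebra A] (C : CylOps n A) : Prop
    extends C.IsBase where
  d_inf_le : ∀ i j k, k ≠ i → k ≠ j → C.d i k ⊓ C.d k j ≤ C.d i j
  d_symm : ∀ i j k, k ≠ i → k ≠ j → C.d i j = C.d j i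
  c_d : ∀ i j k, k ≠ i → k ≠ j → C.d j i = C.c k (C.d j i)

/-- Names of the two classes of algebras. -/
inductive CylClass
  | NCA
  | WCA

/-- `K.Mem C`: the algebra `(A, C)` is a member of the class `K` (in dimension `n`). -/
def CylClass.Mem (K : CylClass) {n : ℕ} {A : Type u} [BooleanAlgebra A] (C : CylOps n A) : Prop :=
  match K with
  | .NCA => C.IsNCA
  | .WCA => C.IsWCA

/-- The equational theory of the `n`-dimensional class `K`: all pairs `(s, t)` such that the
equation `s = t` is valid in every member of `K`. -/
def CylClass.eqTheory (K : CylClass) (n : ℕ) : Set (CylTerm n × CylTerm n) :=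
  {p | ∀ (A : Type u) (_ : BooleanAlgebra A) (C : CylOps n A), K.Mem C →
    ∀ e : ℕ → A, p.1.eval C e = p.2.eval C e}

/-- The equational theory of the finite members of the `n`-dimensional class `K`. -/
def CylClass.finEqTheory (K : CylClass) (n : ℕ) : Set (CylTerm n × CylTerm n) :=
  {p | ∀ (A : Type u) (_ : BooleanAlgebra A) (C : CylOps n A), Finite A → K.Mem C →
    ∀ e : ℕ → A, p.1.eval C e = p.2.eval C e}

/-- The Gödel number of a term. -/
def CylTerm.code {n : ℕ} : CylTerm n → ℕ
  | .var k => Nat.pair 0 k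
  | .zero => Nat.pair 1 0
  | .one => Nat.pair 2 0
  | .diag i j => Nat.pair 3 (Nat.pair i j)
  | .neg t => Nat.pair 4 t.code
  | .cyl i t => Nat.pair 5 (Nat.pair i t.code)
  | .mul s t => Nat.pair 6 (Nat.pair s.code t.code)
  | .add s t => Nat.pair 7 (Nat.pair s.code t.code)

theorem CylTerm.code_injective {n : ℕ} :
    Function.Injective (CylTerm.code : CylTerm n → ℕ) := by
  intro s
  induction s with
  | var k => intro t h; cases t <;> simp_all [CylTerm.code, Nat.pair_eq_pair]
  | zero => intro t h; cases t <;> simp_all [CylTerm.code, Nat.pair_eq_pair]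
  | one => intro t h; cases t <;> simp_all [CylTerm.code, Nat.pair_eq_pair]
  | diag i j =>
    intro t h
    cases t <;> simp_all [CylTerm.code, Nat.pair_eq_pair, Fin.ext_iff]
  | neg s ih =>
    intro t h
    cases t <;> simp [CylTerm.code, Nat.pair_eq_pair] at h
    rw [ih h]
  | cyl i s ih =>
    intro t h
    cases t <;> simp [CylTerm.code, Nat.pair_eq_pair] at h
    rw [ih h.2, Fin.ext h.1]
  | mul s s' ih ih' =>
    intro t h
    cases t <;> simp [CylTerm.code, Nat.pair_eq_pair] at h
    rw [ih h.1, ih' h.2]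
  | add s s' ih ih' =>
    intro t h
    cases t <;> simp [CylTerm.code, Nat.pair_eq_pair] at h
    rw [ih h.1, ih' h.2]

/-- A set of equations is decidable if some algorithm decides, given two natural numbers, whether
they are the Gödel numbers of the two sides of an equation in the set. -/
def DecidableEquations {n : ℕ} (E : Set (CylTerm n × CylTerm n)) : Prop :=
  ComputablePred fun p : ℕ × ℕ => ∃ s t : CylTerm n, s.code = p.1 ∧ t.code = p.2 ∧ (s, t) ∈ E

/-! All three claims follow from a finite model property with a computable bound, proved as in modal
logic.

Suppose `s = t` fails in a member of `K`. The ultrafilters of the algebra form a relational model in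
which each `c_i` is a diamond over an equivalence relation, and some world distinguishes `s` from
`t` (`CylClass.Mem.exists_not_sat_iff`). The equations of `K` turn into first-order frame
conditions; conversely, the complex algebra of a model with these conditions is in `K`.

To make the model finite, fix `c` above the codes of `s`, `t` and all diagonals, and unravel the
model into paths of length at most `c` from the distinguishing world. A step in direction `k` goes
to one of at most `c + 1` witnesses, consecutive steps differ in direction, and two paths are
`k`-related when they agree after deleting a final `k`-step. Passing to a subterm lowers the code by
at least one while the path grows by at most one, so truth of `s` is preserved as long as length
plus code is at most `c` (`IsBase.sat_iff_sat_pathEnd`).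

The conditions of WCA are universal and pass to the path model. Those of NCA also demand worlds on
diagonals in every `k`-class, which paths of maximal length may lack. The remedy is to let worlds be
pairs of an equivalence relation on the indices (the diagonals that hold) and an optional path, and
to name the `k`-classes by maps that are bijective on each label identifying `k` with another index.
Each such label that agrees with the class off `k` then occurs exactly once in it, and the classes
of paths whose root is shorter than `c` gain no new worlds (`IsNCA.exists_completion`).

For decidability, a model on at most `sizeBound n c` worlds, together with the truth of all terms of
code at most `c`, is packed into the bits of one number below a computable bound. The search for a
refutation is then a bounded quantification over a primitive recursive condition. -/

/-- Relational models of type `cyl_n`: accessibility relations for the cylindrifications,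
unary predicates for the diagonals and a valuation of the variables. -/
structure CylModel (n : ℕ) (W : Type u) where
  T : Fin n → W → W → Prop
  E : Fin n → Fin n → W → Prop
  V : ℕ → W → Prop

namespace CylModel

variable {n : ℕ} {W : Type u}

/-- Truth of a term at a world. -/
def Sat (F : CylModel n W) : CylTerm n → W → Prop
  | .var k => F.V k
  | .zero => fun _ => False
  | .one => fun _ => True
  | .diag i j => F.E i j
  | .neg t => fun x => ¬ F.Sat t x
  | .cyl i t => fun x => ∃ y, F.T i x y ∧ F.Sat t y
  | .mul s t => fun x => F.Sat s x ∧ F.Sat t x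
  | .add s t => fun x => F.Sat s x ∨ F.Sat t x

/-- The frame conditions shared by both classes. -/
structure IsBase (F : CylModel n W) : Prop where
  equiv : ∀ i, Equivalence (F.T i)
  E_self : ∀ i x, F.E i i x
  unique : ∀ i j, i ≠ j → ∀ x y, F.T i x y → F.E i j x → F.E i j y → x = y

/-- The frame conditions of non-commutative cylindric algebras. -/
structure IsNCA (F : CylModel n W) : Prop extends F.IsBase where
  E_iff : ∀ i j k, k ≠ i → k ≠ j → ∀ x, F.E i j x ↔ ∃ y, F.T k x y ∧ F.E i k y ∧ F.E k j y

/-- The frame conditions of weakened cylindric algebras. -/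
structure IsWCA (F : CylModel n W) : Prop extends F.IsBase where
  E_trans : ∀ i j k, k ≠ i → k ≠ j → ∀ x, F.E i k x → F.E k j x → F.E i j x
  E_symm : ∀ i j k, k ≠ i → k ≠ j → ∀ x, F.E i j x ↔ F.E j i x
  E_closed : ∀ i j k, k ≠ i → k ≠ j → ∀ x y, F.T k x y → F.E j i x → F.E j i y

/-- The frame conditions of the class `K`. -/
def InClass (F : CylModel n W) (K : CylClass) : Prop :=
  match K with
  | .NCA => F.IsNCA
  | .WCA => F.IsWCA

theorem InClass.isBase {F : CylModel n W} {K : CylClass} (h : F.InClass K) : F.IsBase := by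
  cases K
  · exact IsNCA.toIsBase h
  · exact IsWCA.toIsBase h

/-- The operations of the complex algebra of a model. -/
def complexOps (F : CylModel n W) : CylOps n (Set W) where
  c i X := {x | ∃ y, F.T i x y ∧ y ∈ X}
  d i j := {x | F.E i j x}

theorem eval_complexOps (F : CylModel n W) (t : CylTerm n) :
    t.eval F.complexOps (fun k => {x | F.V k x}) = {x | F.Sat t x} := by
  induction t with
  | var k => rfl
  | zero => rfl
  | one => rfl
  | diag i j => rfl
  | neg t ih => simp only [CylTerm.eval, ih]; rfl
  | cyl i t ih => simp only [CylTerm.eval, ih]; rfl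
  | mul s t ih ih' => simp only [CylTerm.eval, ih, ih']; rfl
  | add s t ih ih' => simp only [CylTerm.eval, ih, ih']; rfl

theorem IsBase.complexOps {F : CylModel n W} (h : F.IsBase) : F.complexOps.IsBase where
  c_bot i := by ext x; simp [CylModel.complexOps]
  le_c i X x hx := ⟨x, (h.equiv i).refl x, hx⟩
  c_inf_c i X Y := by
    ext x
    constructor
    · rintro ⟨y, hxy, hy, z, hyz, hz⟩
      exact ⟨⟨y, hxy, hy⟩, z, (h.equiv i).trans hxy hyz, hz⟩
    · rintro ⟨⟨y, hxy, hy⟩, z, hxz, hz⟩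
      exact ⟨y, hxy, hy, z, (h.equiv i).trans ((h.equiv i).symm hxy) hxz, hz⟩
  d_self i := by ext x; simpa [CylModel.complexOps] using h.E_self i x
  c_d_inf i j hij X := by
    rw [eq_bot_iff]
    rintro x ⟨⟨y, hxy, hy, hyX⟩, z, hxz, hz, hzX⟩
    have := h.unique i j hij y z ((h.equiv i).trans ((h.equiv i).symm hxy) hxz) hy hz
    exact hzX (this ▸ hyX)

theorem InClass.complexOps {F : CylModel n W} {K : CylClass} (h : F.InClass K) :
    K.Mem F.complexOps := by
  have hb := h.isBase
  cases K
  · have h : F.IsNCA := h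
    exact { hb.complexOps with
      d_eq := fun i j k hki hkj => Set.ext fun x => h.E_iff i j k hki hkj x }
  · have h : F.IsWCA := h
    exact { hb.complexOps with
      d_inf_le := fun i j k hki hkj x hx => h.E_trans i j k hki hkj x hx.1 hx.2
      d_symm := fun i j k hki hkj => Set.ext fun x => h.E_symm i j k hki hkj x
      c_d := fun i j k hki hkj => Set.ext fun x =>
        ⟨fun hx => ⟨x, (hb.equiv k).refl x, hx⟩, fun ⟨y, hxy, hy⟩ =>
          h.E_closed i j k hki hkj y x ((hb.equiv k).symm hxy) hy⟩ }

/-- The pullback of a model along a map. -/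
def comap {W' : Type v} (F : CylModel n W) (f : W' → W) : CylModel n W' where
  T i x y := F.T i (f x) (f y)
  E i j x := F.E i j (f x)
  V k x := F.V k (f x)

theorem sat_comap {W' : Type v} (F : CylModel n W) (f : W' ≃ W) (t : CylTerm n) (x : W') :
    (F.comap f).Sat t x ↔ F.Sat t (f x) := by
  induction t generalizing x with
  | var k => rfl
  | zero => rfl
  | one => rfl
  | diag i j => rfl
  | neg t ih => simp only [Sat, ih]
  | cyl i t ih =>
    exact (exists_congr fun y => and_congr Iff.rfl (ih y)).trans
      (f.surjective.exists (p := fun y => F.T i (f x) y ∧ F.Sat t y)).symm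
  | mul s t ih ih' => simp only [Sat, ih, ih']
  | add s t ih ih' => simp only [Sat, ih, ih']

theorem InClass.comap {W' : Type v} {F : CylModel n W} {K : CylClass} (h : F.InClass K)
    (f : W' ≃ W) : (F.comap f).InClass K := by
  have hb := h.isBase
  have hb' : (F.comap f).IsBase :=
    { equiv := fun i => ⟨fun x => (hb.equiv i).refl _, fun h => (hb.equiv i).symm h,
        fun h h' => (hb.equiv i).trans h h'⟩
      E_self := fun i x => hb.E_self i _
      unique := fun i j hij x y h hx hy => f.injective (hb.unique i j hij _ _ h hx hy) }
  cases K
  · have h : F.IsNCA := h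
    refine { hb' with E_iff := fun i j k hki hkj x => ?_ }
    simpa only [CylModel.comap, f.surjective.exists] using h.E_iff i j k hki hkj (f x)
  · have h : F.IsWCA := h
    exact { hb' with
      E_trans := fun i j k hki hkj x => h.E_trans i j k hki hkj _
      E_symm := fun i j k hki hkj x => h.E_symm i j k hki hkj _
      E_closed := fun i j k hki hkj x y => h.E_closed i j k hki hkj _ _ }

end CylModel

/-! ### Ultrafilters and canonical models -/

/-- Ultrafilters of a Boolean algebra. -/
structure BoolUltrafilter (A : Type u) [BooleanAlgebra A] where
  Mem : A → Prop
  mem_inf : ∀ a b, Mem (a ⊓ b) ↔ Mem a ∧ Mem b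
  mem_compl : ∀ a, Mem aᶜ ↔ ¬ Mem a

namespace BoolUltrafilter

variable {A : Type u} [BooleanAlgebra A]

theorem not_mem_bot (x : BoolUltrafilter A) : ¬ x.Mem ⊥ := by
  rw [← inf_compl_self ⊤, x.mem_inf, x.mem_compl]
  tauto

theorem mem_top (x : BoolUltrafilter A) : x.Mem ⊤ := by
  rw [← compl_bot, x.mem_compl]
  exact x.not_mem_bot

theorem mem_of_le (x : BoolUltrafilter A) {a b : A} (h : a ≤ b) (ha : x.Mem a) : x.Mem b := by
  rw [← inf_eq_left.2 h, x.mem_inf] at ha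
  exact ha.2

theorem mem_sup (x : BoolUltrafilter A) (a b : A) : x.Mem (a ⊔ b) ↔ x.Mem a ∨ x.Mem b := by
  rw [← not_iff_not, ← x.mem_compl, compl_sup, x.mem_inf, x.mem_compl, x.mem_compl, not_or]

theorem exists_of_forall_inf_ne_bot (S : Set A) (hS : ⊤ ∈ S)
    (hinf : ∀ y ∈ S, ∀ z ∈ S, y ⊓ z ∈ S) (a : A) (ha : ∀ z ∈ S, z ⊓ a ≠ ⊥) :
    ∃ x : BoolUltrafilter A, (∀ z ∈ S, x.Mem z) ∧ x.Mem a := by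
  -- The filter generated by `S` and `a` is proper; the ultrafilter is the complement of a prime
  -- ideal disjoint from it.
  have hF : Order.IsPFilter {b : A | ∃ z ∈ S, z ⊓ a ≤ b} := by
    refine Order.IsPFilter.of_def ⟨⊤, ⊤, hS, le_top⟩ ?_ ?_
    · rintro b ⟨z, hz, hb⟩ b' ⟨z', hz', hb'⟩
      exact ⟨(z ⊓ z') ⊓ a, ⟨_, hinf z hz z' hz', le_rfl⟩,
        (inf_le_inf_right a inf_le_left).trans hb, (inf_le_inf_right a inf_le_right).trans hb'⟩
    · rintro b b' hbb' ⟨z, hz, hb⟩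
      exact ⟨z, hz, hb.trans hbb'⟩
  obtain ⟨J, hJ, -, hd⟩ := DistribLattice.prime_ideal_of_disjoint_filter_ideal
    (F := hF.toPFilter) (I := Order.Ideal.principal (⊥ : A)) (by
      rw [Set.disjoint_left]
      rintro b ⟨z, hz, hb⟩ hb'
      exact ha z hz (le_bot_iff.1 (hb.trans (Order.Ideal.mem_principal.1 hb'))))
  have hout : ∀ b, (∃ z ∈ S, z ⊓ a ≤ b) → b ∉ J := fun b hb hbJ =>
    Set.disjoint_left.1 hd hb hbJ
  refine ⟨⟨fun b => b ∉ J, fun b b' => ?_, fun b => ?_⟩, fun z hz => hout z ⟨z, hz, inf_le_left⟩,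
    hout a ⟨⊤, hS, inf_le_right⟩⟩
  · rw [← not_or, not_iff_not]
    constructor
    · exact fun h => hJ.mem_or_mem h
    · rintro (h | h)
      · exact J.lower inf_le_left h
      · exact J.lower inf_le_right h
  · rw [not_not]
    constructor
    · intro h
      exact (hJ.mem_or_mem (x := b) (y := bᶜ) (by simp)).resolve_right h
    · intro h h'
      have := J.sup_mem h h'
      rw [sup_compl_eq_top] at this
      exact hout ⊤ ⟨⊤, hS, le_top⟩ this

theorem exists_mem {a : A} (ha : a ≠ ⊥) : ∃ x : BoolUltrafilter A, x.Mem a := by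
  obtain ⟨x, -, hx⟩ := exists_of_forall_inf_ne_bot {⊤} rfl (by simp) a (by simpa using ha)
  exact ⟨x, hx⟩

theorem exists_mem_not_iff {a b : A} (hab : a ≠ b) :
    ∃ x : BoolUltrafilter A, ¬ (x.Mem a ↔ x.Mem b) := by
  by_contra! h
  apply hab
  have key : ∀ a b : A, (∀ x : BoolUltrafilter A, x.Mem a → x.Mem b) → a ≤ b := by
    intro a b h
    by_contra hle
    rw [← sdiff_eq_bot_iff, sdiff_eq] at hle
    obtain ⟨x, hx⟩ := exists_mem hle
    rw [x.mem_inf, x.mem_compl] at hx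
    exact hx.2 (h x hx.1)
  exact le_antisymm (key a b fun x => (h x).1) (key b a fun x => (h x).2)

end BoolUltrafilter

namespace CylOps

variable {n : ℕ} {A : Type u} [BooleanAlgebra A] {C : CylOps n A}

theorem IsBase.c_top (h : C.IsBase) (i : Fin n) : C.c i ⊤ = ⊤ := top_le_iff.1 (h.le_c i ⊤)

theorem IsBase.c_c (h : C.IsBase) (i : Fin n) (a : A) : C.c i (C.c i a) = C.c i a := by
  simpa [h.c_top] using h.c_inf_c i ⊤ a

/-- Closure of the fixed points of `c_i` under complement is what makes the relation of the
canonical model symmetric in effect: containing the fixed points of `x` already means agreeing with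
`x` on all of them. -/
theorem IsBase.c_compl_c (h : C.IsBase) (i : Fin n) (a : A) :
    C.c i (C.c i a)ᶜ = (C.c i a)ᶜ := by
  refine le_antisymm ?_ (h.le_c i _)
  have := h.c_inf_c i (C.c i a)ᶜ a
  rw [compl_inf_self, h.c_bot] at this
  exact le_compl_iff_disjoint_right.2 (disjoint_iff.2 this.symm)

/-- The ultrafilter model of an algebra of type `cyl_n`. -/
def canonicalModel (C : CylOps n A) (e : ℕ → A) : CylModel n (BoolUltrafilter A) where
  T i x y := ∀ a, x.Mem (C.c i a) ↔ y.Mem (C.c i a)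
  E i j x := x.Mem (C.d i j)
  V k x := x.Mem (e k)

/-- The fixed points of `c_i` in `x` are consistent with `a`: if `z ⊓ a = ⊥` for such a `z`, then
`c_i a ⊓ z = c_i (a ⊓ z) = ⊥`, although `x` contains both factors. -/
theorem IsBase.mem_c_iff (h : C.IsBase) (e : ℕ → A) (i : Fin n) (a : A) (x : BoolUltrafilter A) :
    x.Mem (C.c i a) ↔ ∃ y, (C.canonicalModel e).T i x y ∧ y.Mem a := by
  constructor
  · intro hx
    obtain ⟨y, hy, hya⟩ := BoolUltrafilter.exists_of_forall_inf_ne_bot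
      {z | x.Mem z ∧ C.c i z = z} ⟨x.mem_top, h.c_top i⟩
      (by
        rintro y ⟨hy, hy'⟩ z ⟨hz, hz'⟩
        refine ⟨(x.mem_inf _ _).2 ⟨hy, hz⟩, ?_⟩
        have := h.c_inf_c i y z
        rwa [hz', hy'] at this) a
      (by
        rintro z ⟨hz, hz'⟩ hza
        have := h.c_inf_c i a z
        rw [hz', inf_comm, hza, h.c_bot] at this
        apply x.not_mem_bot
        rw [this, x.mem_inf]
        exact ⟨hx, hz⟩)
    refine ⟨y, fun b => ⟨fun hb => hy _ ⟨hb, h.c_c i b⟩, fun hb => ?_⟩, hya⟩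
    by_contra hb'
    rw [← x.mem_compl] at hb'
    exact (y.mem_compl _).1 (hy _ ⟨hb', h.c_compl_c i b⟩) hb
  · rintro ⟨y, hxy, hy⟩
    exact (hxy a).2 (y.mem_of_le (h.le_c i a) hy)

theorem IsBase.sat_canonicalModel (h : C.IsBase) (e : ℕ → A) (t : CylTerm n)
    (x : BoolUltrafilter A) : (C.canonicalModel e).Sat t x ↔ x.Mem (t.eval C e) := by
  induction t generalizing x with
  | var k => rfl
  | zero => exact iff_of_false id x.not_mem_bot
  | one => exact iff_of_true trivial x.mem_top
  | diag i j => rfl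
  | neg t ih => simp only [CylModel.Sat, CylTerm.eval, ih, x.mem_compl]
  | cyl i t ih => simp only [CylModel.Sat, CylTerm.eval, ih, h.mem_c_iff e]
  | mul s t ih ih' => simp only [CylModel.Sat, CylTerm.eval, ih, ih', x.mem_inf]
  | add s t ih ih' => simp only [CylModel.Sat, CylTerm.eval, ih, ih', x.mem_sup]

theorem IsBase.canonicalModel (h : C.IsBase) (e : ℕ → A) : (C.canonicalModel e).IsBase where
  equiv i := ⟨fun x a => Iff.rfl, fun h a => (h a).symm, fun h h' a => (h a).trans (h' a)⟩
  E_self i x := by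
    show x.Mem (C.d i i)
    rw [h.d_self]
    exact x.mem_top
  unique i j hij x y hxy hx hy := by
    have key : ∀ a, x.Mem a → y.Mem a := by
      intro a hxa
      by_contra hya
      rw [← y.mem_compl] at hya
      apply x.not_mem_bot
      rw [← h.c_d_inf i j hij a, x.mem_inf]
      refine ⟨(h.mem_c_iff e i _ x).2 ⟨x, fun _ => Iff.rfl, (x.mem_inf _ _).2 ⟨hx, hxa⟩⟩,
        (h.mem_c_iff e i _ x).2 ⟨y, hxy, (y.mem_inf _ _).2 ⟨hy, hya⟩⟩⟩
    have hm : x.Mem = y.Mem := by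
      funext a
      refine propext ⟨key a, fun hy => ?_⟩
      by_contra hx
      exact (y.mem_compl a).1 (key _ ((x.mem_compl a).2 hx)) hy
    cases x; cases y; cases hm; rfl

end CylOps

theorem CylClass.Mem.isBase {n : ℕ} {A : Type u} [BooleanAlgebra A] {C : CylOps n A}
    {K : CylClass} (h : K.Mem C) : C.IsBase := by
  cases K
  · exact CylOps.IsNCA.toIsBase h
  · exact CylOps.IsWCA.toIsBase h

theorem CylClass.Mem.canonicalModel {n : ℕ} {A : Type u} [BooleanAlgebra A] {C : CylOps n A}
    {K : CylClass} (h : K.Mem C) (e : ℕ → A) : (C.canonicalModel e).InClass K := by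
  have hb := h.isBase
  cases K
  · have h : C.IsNCA := h
    refine { hb.canonicalModel e with E_iff := fun i j k hki hkj x => ?_ }
    show x.Mem (C.d i j) ↔ _
    rw [h.d_eq i j k hki hkj, hb.mem_c_iff e]
    simp only [BoolUltrafilter.mem_inf]
    rfl
  · have h : C.IsWCA := h
    refine { hb.canonicalModel e with
      E_trans := fun i j k hki hkj x hx hx' =>
        x.mem_of_le (h.d_inf_le i j k hki hkj) ((x.mem_inf _ _).2 ⟨hx, hx'⟩)
      E_symm := fun i j k hki hkj x => ?_
      E_closed := fun i j k hki hkj x y hxy hx => ?_ }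
    · show x.Mem (C.d i j) ↔ x.Mem (C.d j i)
      rw [h.d_symm i j k hki hkj]
    · have hx : x.Mem (C.d j i) := hx
      show y.Mem (C.d j i)
      rw [h.c_d i j k hki hkj] at hx ⊢
      exact (hxy _).1 hx

/-- If an equation fails in a member of `K`, its sides differ at a world of a model of `K`. -/
theorem CylClass.Mem.exists_not_sat_iff {n : ℕ} {A : Type u} [BooleanAlgebra A] {C : CylOps n A}
    {K : CylClass} (h : K.Mem C) (e : ℕ → A) {s t : CylTerm n} (hst : s.eval C e ≠ t.eval C e) :
    ∃ (W : Type u) (F : CylModel n W) (x : W), F.InClass K ∧ ¬ (F.Sat s x ↔ F.Sat t x) := by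
  obtain ⟨x, hx⟩ := BoolUltrafilter.exists_mem_not_iff hst
  refine ⟨_, C.canonicalModel e, x, h.canonicalModel e, ?_⟩
  simpa only [h.isBase.sat_canonicalModel] using hx

/-- If the sides of an equation differ at a world of a finite model of `K`, the equation fails in
a finite member of `K`, in every universe. -/
theorem CylModel.InClass.exists_finite_eval_ne {n M : ℕ} {F : CylModel n (Fin M)} {K : CylClass}
    (h : F.InClass K) {s t : CylTerm n} {x : Fin M} (hx : ¬ (F.Sat s x ↔ F.Sat t x)) :
    ∃ (A : Type v) (_ : BooleanAlgebra A) (C : CylOps n A) (e : ℕ → A),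
      Finite A ∧ K.Mem C ∧ s.eval C e ≠ t.eval C e := by
  refine ⟨Set (ULift.{v} (Fin M)), inferInstance, (F.comap Equiv.ulift).complexOps,
    fun k => {x | (F.comap Equiv.ulift).V k x}, inferInstance, (h.comap Equiv.ulift).complexOps,
    fun heq => hx ?_⟩
  rw [eval_complexOps, eval_complexOps] at heq
  have := Set.ext_iff.1 heq ⟨x⟩
  exact ((sat_comap F Equiv.ulift s _).symm.trans this).trans (sat_comap F Equiv.ulift t _)

/-! ### Witnesses and unravelling into short paths -/

theorem CylTerm.code_lt_cyl {n : ℕ} (i : Fin n) (t : CylTerm n) :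
    t.code < (CylTerm.cyl i t).code := by
  have h₁ := Nat.add_le_pair 5 (Nat.pair i t.code)
  have h₂ := Nat.right_le_pair i t.code
  simp only [CylTerm.code]
  omega

theorem CylTerm.code_lt_neg {n : ℕ} (t : CylTerm n) : t.code < (CylTerm.neg t).code := by
  have h₁ := Nat.add_le_pair 4 t.code
  simp only [CylTerm.code]
  omega

theorem CylTerm.code_lt_mul {n : ℕ} (s t : CylTerm n) :
    s.code < (CylTerm.mul s t).code ∧ t.code < (CylTerm.mul s t).code := by
  have h₁ := Nat.add_le_pair 6 (Nat.pair s.code t.code)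
  have h₂ := Nat.right_le_pair s.code t.code
  have h₃ := Nat.left_le_pair s.code t.code
  simp only [CylTerm.code]
  omega

theorem CylTerm.code_lt_add {n : ℕ} (s t : CylTerm n) :
    s.code < (CylTerm.add s t).code ∧ t.code < (CylTerm.add s t).code := by
  have h₁ := Nat.add_le_pair 7 (Nat.pair s.code t.code)
  have h₂ := Nat.right_le_pair s.code t.code
  have h₃ := Nat.left_le_pair s.code t.code
  simp only [CylTerm.code]
  omega

namespace CylModel

variable {n : ℕ} {U : Type u} (F : CylModel n U)

open Classical in
/-- A world accessible from `x` that satisfies the term with Gödel number `a`, if there is one. -/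
noncomputable def witness (k : Fin n) (x : U) (a : ℕ) : U :=
  -- The default `x` is harmless: by reflexivity every value stays in the `k`-class of `x`.
  if h : ∃ y, F.T k x y ∧ ∃ s : CylTerm n, s.code = a ∧ F.Sat s y then h.choose else x

open Classical in
/-- Witnesses for all terms with Gödel number at most `c`. -/
noncomputable def witnesses (c : ℕ) (k : Fin n) (x : U) : Finset U :=
  (Finset.range (c + 1)).image (F.witness k x)

variable {F} {c : ℕ} {k : Fin n}

theorem card_witnesses_le (x : U) : (F.witnesses c k x).card ≤ c + 1 := by
  classical
  exact Finset.card_image_le.trans (Finset.card_range _).le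

theorem exists_mem_witnesses {x y : U} {s : CylTerm n} (hs : s.code ≤ c) (hxy : F.T k x y)
    (hy : F.Sat s y) : ∃ z ∈ F.witnesses c k x, F.T k x z ∧ F.Sat s z := by
  have h : ∃ y, F.T k x y ∧ ∃ s' : CylTerm n, s'.code = s.code ∧ F.Sat s' y :=
    ⟨y, hxy, s, rfl, hy⟩
  classical
  refine ⟨F.witness k x s.code, Finset.mem_image_of_mem _ (Finset.mem_range.2 (by omega)), ?_⟩
  rw [witness, dif_pos h]
  obtain ⟨h₁, s', h₂, h₃⟩ := h.choose_spec
  exact ⟨h₁, CylTerm.code_injective h₂ ▸ h₃⟩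

theorem IsBase.rel_of_mem_witnesses (hF : F.IsBase) {x y : U} (hy : y ∈ F.witnesses c k x) :
    F.T k x y := by
  classical
  obtain ⟨a, -, rfl⟩ := Finset.mem_image.1 hy
  rw [witness]
  split_ifs with h
  · exact h.choose_spec.1
  · exact (hF.equiv k).refl x

/-- The last world of a path that starts at `x₀`. -/
def pathEnd (x₀ : U) : List (Fin n × U) → U
  | [] => x₀
  | (_, y) :: _ => y

/-- The path without its last step if that step is in direction `k`. -/
def pathRoot (k : Fin n) : List (Fin n × U) → List (Fin n × U)
  | [] => []
  | (i, y) :: p => if i = k then p else (i, y) :: p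

variable (F c) in
/-- Paths (latest step first) that move to new witnesses and change direction at every step. -/
def IsPath (x₀ : U) : List (Fin n × U) → Prop
  | [] => True
  | (k, y) :: p => IsPath x₀ p ∧ pathRoot k p = p ∧ y ∈ F.witnesses c k (pathEnd x₀ p) ∧
      y ≠ pathEnd x₀ p

variable {x₀ : U} {p q : List (Fin n × U)}

theorem pathRoot_cons_self (k : Fin n) (y : U) (p : List (Fin n × U)) :
    pathRoot k ((k, y) :: p) = p := if_pos rfl

theorem length_pathRoot_le (k : Fin n) (p : List (Fin n × U)) :
    (pathRoot k p).length ≤ p.length := by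
  rcases p with _ | ⟨⟨i, y⟩, p⟩
  · rfl
  · rw [pathRoot]
    split_ifs <;> simp

theorem length_le_pathRoot (k : Fin n) (p : List (Fin n × U)) :
    p.length ≤ (pathRoot k p).length + 1 := by
  rcases p with _ | ⟨⟨i, y⟩, p⟩
  · simp
  · rw [pathRoot]
    split_ifs <;> simp

theorem IsPath.eq_pathRoot_or (hp : F.IsPath c x₀ p) (k : Fin n) :
    p = pathRoot k p ∨ ∃ y, p = (k, y) :: pathRoot k p ∧
      y ∈ F.witnesses c k (pathEnd x₀ (pathRoot k p)) ∧ y ≠ pathEnd x₀ (pathRoot k p) := by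
  rcases p with _ | ⟨⟨i, y⟩, p⟩
  · exact Or.inl rfl
  · by_cases hik : i = k
    · subst hik
      rw [pathRoot_cons_self]
      exact Or.inr ⟨y, rfl, hp.2.2⟩
    · exact Or.inl (if_neg hik).symm

theorem IsPath.pathRoot (hp : F.IsPath c x₀ p) (k : Fin n) : F.IsPath c x₀ (pathRoot k p) := by
  rcases hp.eq_pathRoot_or k with h | ⟨y, h, -⟩
  · rwa [← h]
  · rw [h] at hp
    exact hp.1

theorem IsPath.pathRoot_pathRoot (hp : F.IsPath c x₀ p) (k : Fin n) :
    CylModel.pathRoot k (CylModel.pathRoot k p) = CylModel.pathRoot k p := by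
  rcases hp.eq_pathRoot_or k with h | ⟨y, h, -⟩
  · rw [← h, ← h]
  · rw [h] at hp
    exact hp.2.1

theorem IsPath.rel_pathEnd (hF : F.IsBase) (hp : F.IsPath c x₀ p) (k : Fin n) :
    F.T k (pathEnd x₀ (CylModel.pathRoot k p)) (pathEnd x₀ p) := by
  rcases hp.eq_pathRoot_or k with h | ⟨y, h, hy, -⟩
  · rw [← h]
    exact (hF.equiv k).refl _
  · rw [h, pathRoot_cons_self]
    exact hF.rel_of_mem_witnesses hy

theorem IsPath.rel_of_pathRoot_eq (hF : F.IsBase) (hp : F.IsPath c x₀ p) (hq : F.IsPath c x₀ q)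
    (h : CylModel.pathRoot k p = CylModel.pathRoot k q) :
    F.T k (pathEnd x₀ p) (pathEnd x₀ q) := by
  have h₁ := hp.rel_pathEnd hF k
  rw [h] at h₁
  exact (hF.equiv k).trans ((hF.equiv k).symm h₁) (hq.rel_pathEnd hF k)

/-- Within one `k`-class the end determines the path, because each step must move and may not repeat
the direction. This transfers the uniqueness condition for diagonals from worlds to paths. -/
theorem IsPath.eq_of_pathRoot_eq (hp : F.IsPath c x₀ p) (hq : F.IsPath c x₀ q)
    (h : CylModel.pathRoot k p = CylModel.pathRoot k q) (he : pathEnd x₀ p = pathEnd x₀ q) :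
    p = q := by
  rcases hp.eq_pathRoot_or k with hp' | ⟨y, hp', -, hy⟩ <;>
    rcases hq.eq_pathRoot_or k with hq' | ⟨z, hq', -, hz⟩
  · rw [hp', hq', h]
  · rw [hq', hp', h] at he
    exact absurd he.symm hz
  · rw [hp', hq', ← h] at he
    exact absurd he hy
  · rw [hp', hq', h] at he ⊢
    have he : y = z := he
    rw [he]

theorem IsPath.exists_pathEnd_eq (hp : F.IsPath c x₀ p) (k : Fin n) {y : U}
    (hy : y ∈ F.witnesses c k (pathEnd x₀ (CylModel.pathRoot k p))) :
    ∃ q, F.IsPath c x₀ q ∧ CylModel.pathRoot k q = CylModel.pathRoot k p ∧ pathEnd x₀ q = y := by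
  by_cases h : y = pathEnd x₀ (CylModel.pathRoot k p)
  · exact ⟨_, hp.pathRoot k, hp.pathRoot_pathRoot k, h.symm⟩
  · exact ⟨(k, y) :: CylModel.pathRoot k p, ⟨hp.pathRoot k, hp.pathRoot_pathRoot k, hy, h⟩,
      pathRoot_cons_self _ _ _, rfl⟩

variable (F c x₀) in
theorem exists_finset_isPath (m : ℕ) : ∃ S : Finset (List (Fin n × U)),
    S.card ≤ (n * (c + 1)) ^ m ∧ ∀ p, F.IsPath c x₀ p → p.length = m → p ∈ S := by
  classical
  induction m with
  | zero => exact ⟨{[]}, by simp, fun p _ hp => by simpa using hp⟩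
  | succ m ih =>
    obtain ⟨S, hS, hmem⟩ := ih
    refine ⟨(S ×ˢ Finset.univ).biUnion fun pk : List (Fin n × U) × Fin n =>
      (F.witnesses c pk.2 (pathEnd x₀ pk.1)).image fun y => (pk.2, y) :: pk.1, ?_, ?_⟩
    · refine (Finset.card_biUnion_le_card_mul _ _ (c + 1) fun pk _ =>
        Finset.card_image_le.trans (card_witnesses_le _)).trans ?_
      rw [Finset.card_product, Finset.card_univ, Fintype.card_fin, mul_assoc, pow_succ]
      exact Nat.mul_le_mul_right _ hS
    · rintro (_ | ⟨⟨k, y⟩, p⟩) hp hm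
      · simp at hm
      · refine Finset.mem_biUnion.2 ⟨(p, k), ?_, Finset.mem_image.2 ⟨y, hp.2.2.1, rfl⟩⟩
        simpa using hmem p hp.1 (by simpa using hm)

variable (F c x₀) in
/-- The paths of length at most `c`. -/
abbrev ShortPath : Type u := {p : List (Fin n × U) // F.IsPath c x₀ p ∧ p.length ≤ c}

variable (F c x₀) in
theorem finite_shortPath : Finite (F.ShortPath c x₀) ∧
    Nat.card (F.ShortPath c x₀) ≤ ∑ m ∈ Finset.range (c + 1), (n * (c + 1)) ^ m := by
  classical
  choose S hS hmem using F.exists_finset_isPath c x₀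
  have hsub : {p | F.IsPath c x₀ p ∧ p.length ≤ c} ⊆
      ((Finset.range (c + 1)).biUnion S : Set (List (Fin n × U))) := fun p hp =>
    Finset.mem_coe.2 (Finset.mem_biUnion.2
      ⟨p.length, Finset.mem_range.2 (Nat.lt_succ_of_le hp.2), hmem _ p hp.1 rfl⟩)
  refine ⟨(Finset.finite_toSet _).subset hsub, ?_⟩
  refine (Nat.card_mono (Finset.finite_toSet _) hsub).trans ?_
  rw [Nat.card_coe_set_eq, Set.ncard_coe_finset]
  exact Finset.card_biUnion_le.trans (Finset.sum_le_sum fun m _ => hS m)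

/-- A model that copies, along `ι`, the clusters of all paths whose root is shorter than `c`
satisfies at `ι p` the same small terms as `F` at the end of `p`. -/
theorem IsBase.sat_iff_sat_pathEnd (hF : F.IsBase) {W : Type v} {G : CylModel n W}
    {ι : F.ShortPath c x₀ → W} (hV : ∀ m p, G.V m (ι p) ↔ F.V m (pathEnd x₀ p.1))
    (hE : ∀ i j p, G.E i j (ι p) ↔ F.E i j (pathEnd x₀ p.1))
    (hT : ∀ k p w, (pathRoot k p.1).length < c →
      (G.T k (ι p) w ↔ ∃ q, w = ι q ∧ pathRoot k q.1 = pathRoot k p.1))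
    (s : CylTerm n) (p : F.ShortPath c x₀) (hs : p.1.length + s.code ≤ c) :
    G.Sat s (ι p) ↔ F.Sat s (pathEnd x₀ p.1) := by
  induction s generalizing p with
  | var m => exact hV m p
  | zero => rfl
  | one => rfl
  | diag i j => exact hE i j p
  | neg t ih =>
    have := t.code_lt_neg
    simp only [Sat, ih p (by omega)]
  | mul s t ih ih' =>
    have := s.code_lt_mul t
    simp only [Sat, ih p (by omega), ih' p (by omega)]
  | add s t ih ih' =>
    have := s.code_lt_add t
    simp only [Sat, ih p (by omega), ih' p (by omega)]
  | cyl k t ih =>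
    have hlt := t.code_lt_cyl k
    have hroot := length_pathRoot_le k p.1
    simp only [Sat]
    -- The possible extra step is paid for by the strictly smaller code of `t`.
    have hlen : ∀ q, pathRoot k q = pathRoot k p.1 → q.length ≤ p.1.length + 1 := by
      intro q hq
      have := length_le_pathRoot k q
      rw [hq] at this
      omega
    constructor
    · rintro ⟨w, hw, ht⟩
      obtain ⟨q, rfl, hq⟩ := (hT k p w (by omega)).1 hw
      have := hlen _ hq
      exact ⟨_, p.2.1.rel_of_pathRoot_eq hF q.2.1 hq.symm, (ih q (by omega)).1 ht⟩
    · rintro ⟨y, hy, ht⟩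
      -- The world `y` need not end a path, so it is replaced by a witness chosen at the root of
      -- `p`, which gives a path in the same `k`-class.
      obtain ⟨z, hz, -, hzt⟩ := exists_mem_witnesses (c := c) (by omega)
        ((hF.equiv k).trans (p.2.1.rel_pathEnd hF k) hy) ht
      obtain ⟨q, hq, hqr, rfl⟩ := p.2.1.exists_pathEnd_eq k hz
      have := hlen _ hqr
      refine ⟨ι ⟨q, hq, by omega⟩, (hT k p _ (by omega)).2 ⟨_, rfl, hqr⟩, (ih _ ?_).2 hzt⟩
      simp only
      omega

/-! ### The finite model for WCA -/

variable (F c x₀) in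
/-- The model whose worlds are the short paths. -/
def pathModel : CylModel n (F.ShortPath c x₀) where
  T k p q := pathRoot k p.1 = pathRoot k q.1
  E i j p := F.E i j (pathEnd x₀ p.1)
  V m p := F.V m (pathEnd x₀ p.1)

theorem IsWCA.pathModel (hF : F.IsWCA) : (F.pathModel c x₀).IsWCA where
  equiv _ := ⟨fun _ => rfl, fun h => h.symm, fun h h' => h.trans h'⟩
  E_self i _ := hF.E_self i _
  unique i j hij p q h hp hq := Subtype.ext (p.2.1.eq_of_pathRoot_eq q.2.1 h
    (hF.unique i j hij _ _ (p.2.1.rel_of_pathRoot_eq hF.toIsBase q.2.1 h) hp hq))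
  E_trans i j k hki hkj _ := hF.E_trans i j k hki hkj _
  E_symm i j k hki hkj _ := hF.E_symm i j k hki hkj _
  E_closed i j k hki hkj p q h :=
    hF.E_closed i j k hki hkj _ _ (p.2.1.rel_of_pathRoot_eq hF.toIsBase q.2.1 h)

theorem IsBase.sat_pathModel (hF : F.IsBase) (s : CylTerm n) (p : F.ShortPath c x₀)
    (hs : p.1.length + s.code ≤ c) :
    (F.pathModel c x₀).Sat s p ↔ F.Sat s (pathEnd x₀ p.1) :=
  hF.sat_iff_sat_pathEnd (G := F.pathModel c x₀) (ι := id) (fun _ _ => Iff.rfl)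
    (fun _ _ _ => Iff.rfl)
    (fun _ _ w _ => ⟨fun h => ⟨w, rfl, h.symm⟩, by rintro ⟨q, rfl, h⟩; exact h.symm⟩) s p hs

/-! ### Labels and the finite model for NCA -/

namespace IsNCA

theorem exists_rel (hF : F.IsNCA) {i k : Fin n} (hik : k ≠ i) (x : U) :
    ∃ y, F.T k x y ∧ F.E i k y ∧ F.E k i y :=
  (hF.E_iff i i k hik hik x).1 (hF.E_self i x)

theorem E_symm (hF : F.IsNCA) {i j : Fin n} {x : U} (h : F.E i j x) : F.E j i x := by
  by_cases hij : i = j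
  · subst hij
    exact h
  · obtain ⟨y, hxy, hji, hy⟩ := hF.exists_rel hij x
    exact (hF.unique i j hij x y hxy h hy) ▸ hji

theorem E_trans (hF : F.IsNCA) {i j k : Fin n} {x : U} (h : F.E i k x) (h' : F.E k j x) :
    F.E i j x := by
  by_cases hki : k = i
  · exact hki ▸ h'
  by_cases hkj : k = j
  · exact hkj ▸ h
  exact (hF.E_iff i j k hki hkj x).2 ⟨x, (hF.equiv k).refl x, h, h'⟩

theorem E_closed (hF : F.IsNCA) {i j k : Fin n} (hki : k ≠ i) (hkj : k ≠ j) {x y : U}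
    (hxy : F.T k x y) : F.E i j x ↔ F.E i j y := by
  rw [hF.E_iff i j k hki hkj x, hF.E_iff i j k hki hkj y]
  exact exists_congr fun z => and_congr_left fun _ =>
    ⟨(hF.equiv k).trans ((hF.equiv k).symm hxy), (hF.equiv k).trans hxy⟩

/-- The diagonals that hold at a world. -/
def label (hF : F.IsNCA) (x : U) : Setoid (Fin n) where
  r i j := F.E i j x
  iseqv := ⟨fun i => hF.E_self i x, hF.E_symm, hF.E_trans⟩

end IsNCA

/-- The part of an equivalence relation that does not involve `k`. -/
def restrict (k : Fin n) (ε : Setoid (Fin n)) (i j : Fin n) : Prop := i ≠ k ∧ j ≠ k ∧ ε i j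

/-- The equivalence relation identifies `k` with some other element. -/
def Special (k : Fin n) (ε : Setoid (Fin n)) : Prop := ∃ j, k ≠ j ∧ ε k j

instance finite_setoid (n : ℕ) : Finite (Setoid (Fin n)) :=
  Finite.of_injective (fun ε : Setoid (Fin n) => ε.r) fun _ _ h =>
    Setoid.ext fun a b => iff_of_eq (congrFun (congrFun h a) b)

/-- Every index has a representative other than `k`, with `j` standing in for `k`, so the relation
is determined off `k`. -/
theorem setoid_ext_of_restrict {k j : Fin n} (hkj : k ≠ j) {ε ε' : Setoid (Fin n)}
    (h : restrict k ε = restrict k ε') (hε : ε k j) (hε' : ε' k j) : ε = ε' := by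
  have key : ∀ ε ε' : Setoid (Fin n), restrict k ε = restrict k ε' → ε k j → ε' k j →
      ∀ a b, ε a b → ε' a b := by
    intro ε ε' h hε hε' a b hab
    have hrep : ∀ a, ∃ a', a' ≠ k ∧ ε a a' ∧ ε' a a' := by
      intro a
      by_cases ha : a = k
      · exact ⟨j, hkj.symm, ha ▸ hε, ha ▸ hε'⟩
      · exact ⟨a, ha, ε.refl a, ε'.refl a⟩
    obtain ⟨a', ha', ha, ha₂⟩ := hrep a
    obtain ⟨b', hb', hb, hb₂⟩ := hrep b
    have h' : restrict k ε a' b' := ⟨ha', hb', ε.trans (ε.symm ha) (ε.trans hab hb)⟩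
    rw [h] at h'
    exact ε'.trans ha₂ (ε'.trans h'.2.2 (ε'.symm hb₂))
  exact Setoid.ext fun a b => ⟨key ε ε' h hε hε' a b, key ε' ε h.symm hε' hε a b⟩

/-- The equivalence relation that moves `k` to the class of `j`. -/
def moveTo (k j : Fin n) (ε : Setoid (Fin n)) : Setoid (Fin n) :=
  ε.comap fun i => if i = k then j else i

theorem moveTo_apply (k j : Fin n) (ε : Setoid (Fin n)) :
    moveTo k j ε k j := by
  show ε (if k = k then j else k) (if j = k then j else j)
  simp only [if_true, ite_self]
  exact ε.refl j

theorem restrict_moveTo (k j : Fin n) (ε : Setoid (Fin n)) :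
    restrict k (moveTo k j ε) = restrict k ε := by
  funext a b
  refine propext (and_congr_right fun ha => and_congr_right fun hb => ?_)
  show ε (if a = k then j else a) (if b = k then j else b) ↔ ε a b
  rw [if_neg ha, if_neg hb]

/-- A partial map on a finite type extends to a map on the type with an extra point that is either
bijective, or sends nothing else to an old point. -/
theorem exists_extension {P : Type u} [Finite P] (D : P → Prop) (f : P → P) (B : Prop)
    (hf : B → ∀ p q, D p → D q → f p = f q → p = q) :
    ∃ σ : Option P → Option P, (∀ p, D p → σ (some p) = some (f p)) ∧
      (B → Function.Bijective σ) ∧ (¬ B → ∀ q, σ q ≠ none → ∃ p, q = some p ∧ D p) := by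
  classical
  have := Fintype.ofFinite P
  by_cases hB : B
  · obtain ⟨g, hg⟩ := Finset.exists_equiv_extend_of_card_eq (α := Option P) (β := Option P)
      (t := Finset.univ) (by simp) (s := Finset.univ.filter fun q => ∃ p, q = some p ∧ D p)
      (f := Option.map f) (Finset.subset_univ _) (by
        intro q hq q' hq' h
        simp only [Finset.coe_filter, Finset.mem_univ, true_and, Set.mem_ofPred_eq] at hq hq'
        obtain ⟨p, rfl, hp⟩ := hq
        obtain ⟨p', rfl, hp'⟩ := hq'
        rw [hf hB p p' hp hp' (by simpa using h)])
    refine ⟨fun q => (g q : Option P), fun p hp => ?_, fun _ => ?_, fun h => absurd hB h⟩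
    · exact hg (some p) (by simpa using hp)
    · refine ⟨Subtype.val_injective.comp g.injective, fun q => ?_⟩
      obtain ⟨q', hq'⟩ := g.surjective ⟨q, Finset.mem_univ q⟩
      exact ⟨q', congrArg Subtype.val hq'⟩
  · refine ⟨fun q => q.bind fun p => if D p then some (f p) else none, fun p hp => by simp [hp],
      fun h => absurd h hB, fun _ q hq => ?_⟩
    rcases q with _ | p
    · simp at hq
    · refine ⟨p, rfl, ?_⟩
      by_contra h
      simp [h] at hq

namespace IsNCA

theorem restrict_label_eq (hF : F.IsNCA) {x y : U} (hxy : F.T k x y) :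
    restrict k (hF.label x) = restrict k (hF.label y) := by
  funext a b
  exact propext (and_congr_right fun ha => and_congr_right fun hb =>
    hF.E_closed (Ne.symm ha) (Ne.symm hb) hxy)

/-- `σ` names the `k`-class of a world with label `ε`. A genuine path is sent to its root. For
special `ε` this is injective, as two paths in one `k`-class on a common diagonal coincide, and so
it extends to a bijection. For other `ε` all remaining points go to `none`, which is the root of no
path. -/
theorem exists_cluster_map (hF : F.IsNCA) (k : Fin n) (ε : Setoid (Fin n)) :
    ∃ σ : Option (F.ShortPath c x₀) → Option (F.ShortPath c x₀),
      (∀ p, (hF.label (pathEnd x₀ p.1) = ε ∧ (pathRoot k p.1).length < c) →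
        σ (some p) = some ⟨pathRoot k p.1, p.2.1.pathRoot k, (length_pathRoot_le k _).trans p.2.2⟩) ∧
      (Special k ε → Function.Bijective σ) ∧
      (¬ Special k ε → ∀ q, σ q ≠ none → ∃ p, q = some p ∧
        (hF.label (pathEnd x₀ p.1) = ε ∧ (pathRoot k p.1).length < c)) := by
  have := (F.finite_shortPath c x₀).1
  refine exists_extension _ _ _ ?_
  rintro ⟨j, hkj, hε⟩ p q ⟨rfl, -⟩ ⟨hq, -⟩ h
  have h := congrArg Subtype.val h
  refine Subtype.ext (p.2.1.eq_of_pathRoot_eq q.2.1 h (hF.unique k j hkj _ _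
    (p.2.1.rel_of_pathRoot_eq hF.toIsBase q.2.1 h) hε ?_))
  rw [← hq] at hε
  exact hε

end IsNCA

/-- A finite model whose worlds are indexed by their labels and a set of short paths. -/
def completion (hF : F.IsNCA)
    (σ : Fin n → Setoid (Fin n) → Option (F.ShortPath c x₀) → Option (F.ShortPath c x₀)) :
    CylModel n (Setoid (Fin n) × Option (F.ShortPath c x₀)) where
  T k w w' := restrict k w.1 = restrict k w'.1 ∧ σ k w.1 w.2 = σ k w'.1 w'.2
  E i j w := w.1 i j
  V m w := ∃ p, w.2 = some p ∧ hF.label (pathEnd x₀ p.1) = w.1 ∧ F.V m (pathEnd x₀ p.1)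

/-- Injectivity of `σ` on special labels gives uniqueness on diagonals. Surjectivity gives
existence: move `k` to the class of `j` and pick the second coordinate with the required class name.
-/
theorem IsNCA.completion (hF : F.IsNCA)
    {σ : Fin n → Setoid (Fin n) → Option (F.ShortPath c x₀) → Option (F.ShortPath c x₀)}
    (hσ : ∀ k ε, Special k ε → Function.Bijective (σ k ε)) :
    (CylModel.completion hF σ).IsNCA where
  equiv k := ⟨fun _ => ⟨rfl, rfl⟩, fun h => ⟨h.1.symm, h.2.symm⟩,
    fun h h' => ⟨h.1.trans h'.1, h.2.trans h'.2⟩⟩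
  E_self i w := w.1.refl i
  unique := by
    rintro i j hij ⟨ε, q⟩ ⟨ε', q'⟩ ⟨h₁, h₂⟩ hε hε'
    obtain rfl : ε = ε' := setoid_ext_of_restrict hij h₁ hε hε'
    exact Prod.ext rfl ((hσ i ε ⟨j, hij, hε⟩).1 h₂)
  E_iff := by
    rintro i j k hki hkj ⟨ε, q⟩
    constructor
    · intro hε
      have hε : ε i j := hε
      have hm := moveTo_apply k j ε
      obtain ⟨q', hq'⟩ := (hσ k (moveTo k j ε) ⟨j, hkj, hm⟩).2 (σ k ε q)
      refine ⟨(moveTo k j ε, q'), ⟨(restrict_moveTo k j ε).symm, hq'.symm⟩, ?_, hm⟩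
      have h : restrict k ε i j := ⟨hki.symm, hkj.symm, hε⟩
      rw [← restrict_moveTo k j ε] at h
      exact (moveTo k j ε).trans h.2.2 ((moveTo k j ε).symm hm)
    · rintro ⟨⟨ε', q'⟩, ⟨h, -⟩, h₁, h₂⟩
      have h' : restrict k ε' i j := ⟨hki.symm, hkj.symm, ε'.trans h₁ h₂⟩
      have h : restrict k ε = restrict k ε' := h
      rw [← h] at h'
      exact h'.2.2

theorem IsNCA.exists_completion (hF : F.IsNCA) (hc : ∀ i j : Fin n, (CylTerm.diag i j).code ≤ c) :
    ∃ G : CylModel n (Setoid (Fin n) × Option (F.ShortPath c x₀)), G.IsNCA ∧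
      ∀ (s : CylTerm n) (p : F.ShortPath c x₀), p.1.length + s.code ≤ c →
        (G.Sat s (hF.label (pathEnd x₀ p.1), some p) ↔ F.Sat s (pathEnd x₀ p.1)) := by
  choose σ hσ₁ hσ₂ hσ₃ using hF.exists_cluster_map (c := c) (x₀ := x₀)
  refine ⟨CylModel.completion hF σ, hF.completion hσ₂, hF.toIsBase.sat_iff_sat_pathEnd
    (ι := fun p => (hF.label (pathEnd x₀ p.1), some p)) ?_ (fun _ _ _ => Iff.rfl) ?_⟩
  · intro m p
    constructor
    · rintro ⟨q, hq, -, h⟩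
      rwa [Option.some.inj hq]
    · exact fun h => ⟨p, rfl, rfl, h⟩
  · rintro k p ⟨ε, q⟩ hp
    constructor
    · rintro ⟨h₁, h₂⟩
      simp only at h₁ h₂
      rw [hσ₁ k _ p ⟨rfl, hp⟩] at h₂
      by_cases hε : Special k ε
      · obtain ⟨j, hkj, hε'⟩ := id hε
        -- For a special label a genuine path already occupies the place: `c` bounds the codes of
        -- diagonals, so the diagonal point of the class is among the witnesses, and its label must
        -- be `ε`. Injectivity of `σ` then forces `q` to be this path.
        obtain ⟨y, hy, -, hyE⟩ := hF.exists_rel hkj (pathEnd x₀ (pathRoot k p.1))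
        obtain ⟨z, hz, hz', hzE⟩ := exists_mem_witnesses (s := CylTerm.diag k j) (hc k j) hy hyE
        obtain ⟨q', hq', hqr, rfl⟩ := p.2.1.exists_pathEnd_eq k hz
        have hlen := length_le_pathRoot k q'
        rw [hqr] at hlen
        have hlab : hF.label (pathEnd x₀ q') = ε := by
          refine setoid_ext_of_restrict hkj ?_ hzE hε'
          rw [← h₁]
          exact hF.restrict_label_eq (hq'.rel_of_pathRoot_eq hF.toIsBase p.2.1 hqr)
        refine ⟨⟨q', hq', by omega⟩, Prod.ext hlab.symm ((hσ₂ k ε hε).1 ?_), hqr⟩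
        rw [← h₂, hσ₁ k ε _ ⟨hlab, by rwa [hqr]⟩]
        simp only [hqr]
      · obtain ⟨q', rfl, hq', hlen⟩ := hσ₃ k ε hε q (by rw [← h₂]; simp)
        refine ⟨q', Prod.ext hq'.symm rfl, ?_⟩
        rw [hσ₁ k ε q' ⟨hq', hlen⟩] at h₂
        exact (congrArg Subtype.val (Option.some.inj h₂)).symm
    · rintro ⟨q', hq', hqr⟩
      obtain ⟨rfl, rfl⟩ := Prod.ext_iff.1 hq'
      refine ⟨hF.restrict_label_eq (p.2.1.rel_of_pathRoot_eq hF.toIsBase q'.2.1 hqr.symm), ?_⟩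
      simp only
      rw [hσ₁ k _ p ⟨rfl, hp⟩, hσ₁ k _ q' ⟨rfl, by rwa [hqr]⟩]
      simp only [hqr]

theorem InClass.exists_fin {W : Type u} [Finite W] {G : CylModel n W} {K : CylClass}
    (hG : G.InClass K) {s t : CylTerm n} {x : W} (hx : ¬ (G.Sat s x ↔ G.Sat t x)) {N : ℕ}
    (hN : Nat.card W ≤ N) :
    ∃ M ≤ N, ∃ (H : CylModel n (Fin M)) (y : Fin M), H.InClass K ∧ ¬ (H.Sat s y ↔ H.Sat t y) := by
  have e := Finite.equivFin W
  refine ⟨_, hN, G.comap e.symm, e x, hG.comap e.symm, ?_⟩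
  rwa [sat_comap, sat_comap, e.symm_apply_apply]

/-! ### The size bound -/

/-- A bound for the size of models in which terms with Gödel numbers at most `c` differ. -/
noncomputable def sizeBound (n c : ℕ) : ℕ :=
  Nat.card (Setoid (Fin n)) * ((c + 1) * (n * (c + 1) + 1) ^ c + 1)

theorem InClass.exists_fin_le_sizeBound {K : CylClass} (hF : F.InClass K) {s t : CylTerm n}
    (hx : ¬ (F.Sat s x₀ ↔ F.Sat t x₀)) (hs : s.code ≤ c) (ht : t.code ≤ c)
    (hc : ∀ i j : Fin n, (CylTerm.diag i j).code ≤ c) :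
    ∃ M ≤ sizeBound n c, ∃ (H : CylModel n (Fin M)) (y : Fin M),
      H.InClass K ∧ ¬ (H.Sat s y ↔ H.Sat t y) := by
  obtain ⟨hfin, hsum⟩ := F.finite_shortPath c x₀
  have hcard : Nat.card (F.ShortPath c x₀) ≤ (c + 1) * (n * (c + 1) + 1) ^ c := by
    refine hsum.trans ((Finset.sum_le_card_nsmul _ _ ((n * (c + 1) + 1) ^ c) fun m hm => ?_).trans
      (by simp))
    exact (Nat.pow_le_pow_left (Nat.le_succ _) m).trans
      (Nat.pow_le_pow_right (Nat.succ_pos _) (Nat.le_of_lt_succ (Finset.mem_range.1 hm)))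
  have hpos : 0 < Nat.card (Setoid (Fin n)) := Nat.card_pos
  let p : F.ShortPath c x₀ := ⟨[], trivial, Nat.zero_le c⟩
  have hps : p.1.length + s.code ≤ c := by simpa [p] using hs
  have hpt : p.1.length + t.code ≤ c := by simpa [p] using ht
  cases K
  · have hF : F.IsNCA := hF
    obtain ⟨G, hG, hsat⟩ := hF.exists_completion (x₀ := x₀) hc
    refine InClass.exists_fin (K := .NCA) (x := (hF.label (pathEnd x₀ p.1), some p)) hG
      (by rwa [hsat s p hps, hsat t p hpt]) ?_
    rw [Nat.card_prod, Finite.card_option]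
    exact Nat.mul_le_mul_left _ (Nat.succ_le_succ hcard)
  · have hF : F.IsWCA := hF
    refine InClass.exists_fin (K := .WCA) (G := F.pathModel c x₀) (x := p) hF.pathModel
      (by rwa [hF.toIsBase.sat_pathModel s p hps, hF.toIsBase.sat_pathModel t p hpt]) ?_
    exact (hcard.trans (Nat.le_succ _)).trans (Nat.le_mul_of_pos_left _ hpos)

end CylModel

/-! ### A language for primitive recursive predicates -/

/-- This turns quantification over subsets of an initial segment into bounded quantification over
numbers. -/
theorem Nat.exists_testBit_iff (B : ℕ) (S : ℕ → Prop) :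
    ∃ z < 2 ^ B, ∀ i < B, z.testBit i = true ↔ S i := by
  classical
  refine ⟨Nat.ofBits fun i : Fin B => decide (S i), Nat.ofBits_lt_two_pow _, fun i hi => ?_⟩
  rw [Nat.testBit_ofBits_lt _ _ hi]
  simp

theorem Nat.pair_le_pair {a b a' b' : ℕ} (ha : a ≤ a') (hb : b ≤ b') :
    Nat.pair a b ≤ Nat.pair a' b' := by
  have h₁ : Nat.pair a b ≤ Nat.pair a' b := by
    rcases ha.eq_or_lt with rfl | h
    · rfl
    · exact (Nat.pair_lt_pair_left b h).le
  have h₂ : Nat.pair a' b ≤ Nat.pair a' b' := by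
    rcases hb.eq_or_lt with rfl | h
    · rfl
    · exact (Nat.pair_lt_pair_right a' h).le
  exact h₁.trans h₂

/-- A primitive recursive function of a list of numbers. -/
structure PrimTerm where
  val : List ℕ → ℕ
  prim : Primrec val

/-- A primitive recursive property of lists of numbers. -/
structure PrimForm where
  holds : List ℕ → Prop
  prim : PrimrecPred holds

namespace PrimTerm

/-- The entry of the list at position `i`. -/
def var (i : ℕ) : PrimTerm :=
  ⟨fun l => l.getD i 0, (Primrec.list_getD 0).comp Primrec.id (Primrec.const i)⟩

def const (a : ℕ) : PrimTerm := ⟨fun _ => a, Primrec.const a⟩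

def pair (s t : PrimTerm) : PrimTerm :=
  ⟨fun l => Nat.pair (s.val l) (t.val l), Primrec₂.natPair.comp s.prim t.prim⟩

def add (s t : PrimTerm) : PrimTerm :=
  ⟨fun l => s.val l + t.val l, Primrec.nat_add.comp s.prim t.prim⟩

def mul (s t : PrimTerm) : PrimTerm :=
  ⟨fun l => s.val l * t.val l, Primrec.nat_mul.comp s.prim t.prim⟩

def pow (s t : PrimTerm) : PrimTerm :=
  ⟨fun l => s.val l ^ t.val l, (Primrec₂.unpaired'.1 Nat.Primrec.pow).comp s.prim t.prim⟩

end PrimTerm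

namespace PrimForm

def eq (s t : PrimTerm) : PrimForm :=
  ⟨fun l => s.val l = t.val l, Primrec.eq.comp s.prim t.prim⟩

def le (s t : PrimTerm) : PrimForm :=
  ⟨fun l => s.val l ≤ t.val l, Primrec.nat_le.comp s.prim t.prim⟩

def bit (s t : PrimTerm) : PrimForm :=
  ⟨fun l => (s.val l).testBit (t.val l) = true,
    (Primrec.eq.comp (Primrec.nat_mod.comp (Primrec.nat_div.comp s.prim
      ((PrimTerm.const 2).pow t).prim) (Primrec.const 2)) (Primrec.const 1)).of_eq fun l => by
      rw [Nat.testBit_eq_decide_div_mod_eq, decide_eq_true_iff]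
      rfl⟩

def not (p : PrimForm) : PrimForm := ⟨fun l => ¬ p.holds l, p.prim.not⟩

def and (p q : PrimForm) : PrimForm := ⟨fun l => p.holds l ∧ q.holds l, p.prim.and q.prim⟩

def or (p q : PrimForm) : PrimForm := ⟨fun l => p.holds l ∨ q.holds l, p.prim.or q.prim⟩

def imp (p q : PrimForm) : PrimForm :=
  ⟨fun l => p.holds l → q.holds l, (p.prim.not.or q.prim).of_eq fun _ => imp_iff_not_or.symm⟩

def iff (p q : PrimForm) : PrimForm :=
  ⟨fun l => p.holds l ↔ q.holds l, ((p.imp q).prim.and (q.imp p).prim).of_eq fun _ =>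
    iff_iff_implies_and_implies.symm⟩

/-- The bound variable is put in front of the list, so variables are de Bruijn indices: `var 0` is
the innermost one. -/
def all (s : PrimTerm) (p : PrimForm) : PrimForm :=
  ⟨fun l => ∀ x < s.val l, p.holds (x :: l),
    ((PrimrecRel.forall_mem_list (R := fun x l => p.holds (x :: l))
      (p.prim.comp Primrec.list_cons)).comp (Primrec.list_range.comp s.prim) Primrec.id).of_eq
      fun l => by simp⟩

def ex (s : PrimTerm) (p : PrimForm) : PrimForm :=
  ⟨fun l => ∃ x < s.val l, p.holds (x :: l),
    ((PrimrecRel.exists_mem_list (R := fun x l => p.holds (x :: l))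
      (p.prim.comp Primrec.list_cons)).comp (Primrec.list_range.comp s.prim) Primrec.id).of_eq
      fun l => by simp⟩

end PrimForm

/-! ### Recognition of Gödel numbers -/

/-- Being the Gödel number of a term. -/
def IsCode (n a : ℕ) : Prop := ∃ s : CylTerm n, s.code = a

open PrimTerm PrimForm in
/-- The property of `[a, z, b]` that `a` codes a term, provided that the subterms whose codes are
less than `b` are found in the set coded by `z`. -/
def codeStepForm (n : ℕ) : PrimForm :=
  or (ex (var 2) (eq (var 1) (pair (const 0) (var 0)))) <|
  or (eq (var 0) (const (Nat.pair 1 0))) <|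
  or (eq (var 0) (const (Nat.pair 2 0))) <|
  or (ex (const n) (ex (const n) (eq (var 2) (pair (const 3) (pair (var 1) (var 0)))))) <|
  or (ex (var 2) (and (eq (var 1) (pair (const 4) (var 0))) (bit (var 2) (var 0)))) <|
  or (ex (const n) (ex (var 3) (and (eq (var 2) (pair (const 5) (pair (var 1) (var 0))))
    (bit (var 3) (var 0))))) <|
  or (ex (var 2) (ex (var 3) (and (eq (var 2) (pair (const 6) (pair (var 1) (var 0))))
    (and (bit (var 3) (var 1)) (bit (var 3) (var 0))))))
    (ex (var 2) (ex (var 3) (and (eq (var 2) (pair (const 7) (pair (var 1) (var 0))))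
    (and (bit (var 3) (var 1)) (bit (var 3) (var 0))))))

open PrimTerm PrimForm in
/-- The property of `[b]` that some set of numbers less than `b + 1` contains `b` and is closed
under passing to subterms. -/
def codeForm (n : ℕ) : PrimForm :=
  ex (pow (const 2) (add (var 0) (const 1))) <| and (bit (var 0) (var 1)) <|
    all (add (var 1) (const 1)) <| imp (bit (var 1) (var 0)) <|
      ⟨fun l => (codeStepForm n).holds [l.getD 0 0, l.getD 1 0, l.getD 2 0 + 1],
        (codeStepForm n).prim.comp <| Primrec.list_cons.comp (var 0).prim <|
          Primrec.list_cons.comp (var 1).prim <|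
            Primrec.list_cons.comp ((var 2).add (const 1)).prim (Primrec.const [])⟩

theorem codeStepForm_holds (n a z b : ℕ) : (codeStepForm n).holds [a, z, b] ↔
    (∃ k < b, a = Nat.pair 0 k) ∨ a = Nat.pair 1 0 ∨ a = Nat.pair 2 0 ∨
    (∃ i < n, ∃ j < n, a = Nat.pair 3 (Nat.pair i j)) ∨
    (∃ s < b, a = Nat.pair 4 s ∧ z.testBit s = true) ∨
    (∃ i < n, ∃ s < b, a = Nat.pair 5 (Nat.pair i s) ∧ z.testBit s = true) ∨
    (∃ s < b, ∃ t < b, a = Nat.pair 6 (Nat.pair s t) ∧ z.testBit s = true ∧ z.testBit t = true) ∨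
    (∃ s < b, ∃ t < b, a = Nat.pair 7 (Nat.pair s t) ∧ z.testBit s = true ∧
      z.testBit t = true) := Iff.rfl

theorem codeForm_holds (n b : ℕ) : (codeForm n).holds [b] ↔
    ∃ z < 2 ^ (b + 1), z.testBit b = true ∧
      ∀ a < b + 1, z.testBit a = true → (codeStepForm n).holds [a, z, b + 1] := Iff.rfl

/-- Guessing a set closed under subterms replaces course-of-values recursion. Subterms have smaller
codes, so strong induction shows that all members of such a set code terms; conversely, the set of
all codes up to `b` qualifies. -/
theorem codeForm_holds_iff (n b : ℕ) : (codeForm n).holds [b] ↔ IsCode n b := by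
  rw [codeForm_holds]
  constructor
  · rintro ⟨z, -, hb, h⟩
    have key : ∀ a, a < b + 1 → z.testBit a = true → IsCode n a := by
      intro a
      induction a using Nat.strong_induction_on with
      | _ a ih =>
        intro hab ha
        have h := h a hab ha
        rw [codeStepForm_holds] at h
        rcases h with ⟨k, -, h⟩ | h | h | ⟨i, hi, j, hj, h⟩ | ⟨s, -, h, hs⟩ | ⟨i, hi, s, -, h, hs⟩ |
          ⟨s, -, t, -, h, hs, ht⟩ | ⟨s, -, t, -, h, hs, ht⟩
        · exact ⟨.var k, h.symm⟩
        · exact ⟨.zero, h.symm⟩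
        · exact ⟨.one, h.symm⟩
        · exact ⟨.diag ⟨i, hi⟩ ⟨j, hj⟩, h.symm⟩
        · have h₁ := Nat.add_le_pair 4 s
          obtain ⟨s, rfl⟩ := ih s (by omega) (by omega) hs
          exact ⟨.neg s, h.symm⟩
        · have h₁ := Nat.add_le_pair 5 (Nat.pair i s)
          have h₂ := Nat.right_le_pair i s
          obtain ⟨s, rfl⟩ := ih s (by omega) (by omega) hs
          exact ⟨.cyl ⟨i, hi⟩ s, h.symm⟩
        · have h₁ := Nat.add_le_pair 6 (Nat.pair s t)
          have h₂ := Nat.left_le_pair s t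
          have h₃ := Nat.right_le_pair s t
          obtain ⟨s, rfl⟩ := ih s (by omega) (by omega) hs
          obtain ⟨t, rfl⟩ := ih t (by omega) (by omega) ht
          exact ⟨.mul s t, h.symm⟩
        · have h₁ := Nat.add_le_pair 7 (Nat.pair s t)
          have h₂ := Nat.left_le_pair s t
          have h₃ := Nat.right_le_pair s t
          obtain ⟨s, rfl⟩ := ih s (by omega) (by omega) hs
          obtain ⟨t, rfl⟩ := ih t (by omega) (by omega) ht
          exact ⟨.add s t, h.symm⟩
    exact key b (Nat.lt_succ_self b) hb
  · intro hb
    obtain ⟨z, hz, hbit⟩ := Nat.exists_testBit_iff (b + 1) (IsCode n)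
    refine ⟨z, hz, (hbit b (Nat.lt_succ_self b)).2 hb, fun a hab ha => ?_⟩
    obtain ⟨s, rfl⟩ := (hbit a hab).1 ha
    rw [codeStepForm_holds]
    cases s with
    | var k =>
      have := Nat.right_le_pair 0 k
      exact .inl ⟨k, this.trans_lt hab, rfl⟩
    | zero => exact .inr (.inl rfl)
    | one => exact .inr (.inr (.inl rfl))
    | diag i j => exact .inr (.inr (.inr (.inl ⟨i, i.2, j, j.2, rfl⟩)))
    | neg s =>
      have hs := s.code_lt_neg.trans hab
      exact .inr (.inr (.inr (.inr (.inl ⟨s.code, hs, rfl, (hbit _ hs).2 ⟨s, rfl⟩⟩))))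
    | cyl i s =>
      have hs := (s.code_lt_cyl i).trans hab
      exact .inr (.inr (.inr (.inr (.inr (.inl
        ⟨i, i.2, s.code, hs, rfl, (hbit _ hs).2 ⟨s, rfl⟩⟩)))))
    | mul s t =>
      have hs := (s.code_lt_mul t).1.trans hab
      have ht := (s.code_lt_mul t).2.trans hab
      exact .inr (.inr (.inr (.inr (.inr (.inr (.inl ⟨s.code, hs, t.code, ht, rfl,
        (hbit _ hs).2 ⟨s, rfl⟩, (hbit _ ht).2 ⟨t, rfl⟩⟩))))))
    | add s t =>
      have hs := (s.code_lt_add t).1.trans hab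
      have ht := (s.code_lt_add t).2.trans hab
      exact .inr (.inr (.inr (.inr (.inr (.inr (.inr ⟨s.code, hs, t.code, ht, rfl,
        (hbit _ hs).2 ⟨s, rfl⟩, (hbit _ ht).2 ⟨t, rfl⟩⟩))))))

/-- Being the Gödel number of a term, as a property of the first entry of a list. -/
def isCodeForm (n : ℕ) (s : PrimTerm) : PrimForm :=
  ⟨fun l => IsCode n (s.val l), ((codeForm n).prim.comp (Primrec.list_cons.comp s.prim
    (Primrec.const []))).of_eq fun _ => codeForm_holds_iff n _⟩

/-! ### Finite models coded by numbers -/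

/-- The accessibility relations coded by the bits of `z`. -/
def bitRel (z i x y : ℕ) : Prop := z.testBit (Nat.pair 0 (Nat.pair i (Nat.pair x y))) = true

/-- The truth of terms (given by their codes) coded by the bits of `z`. -/
def bitSat (z a x : ℕ) : Prop := z.testBit (Nat.pair 1 (Nat.pair a x)) = true

/-- The diagonals coded by the bits of `z`. -/
def bitDiag (z i j x : ℕ) : Prop := bitSat z (Nat.pair 3 (Nat.pair i j)) x

/-- The model on `Fin M` coded by the bits of `z`. -/
def bitModel (n M z : ℕ) : CylModel n (Fin M) where
  T i x y := bitRel z i x y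
  E i j x := bitDiag z i j x
  V m x := bitSat z (Nat.pair 0 m) x

namespace CylModel

variable {n : ℕ} {W : Type u}

/-- The frame conditions do not mention the valuation; a coded model may differ from the original on
variables with codes above `c`. -/
theorem InClass.of_eq {F G : CylModel n W} {K : CylClass} (hF : F.InClass K) (hT : G.T = F.T)
    (hE : G.E = F.E) : G.InClass K := by
  cases F
  cases G
  obtain rfl : _ = _ := hT
  obtain rfl : _ = _ := hE
  have hb := hF.isBase
  cases K
  · have h : IsNCA _ := hF
    exact IsNCA.mk ⟨hb.1, hb.2, hb.3⟩ h.E_iff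
  · have h : IsWCA _ := hF
    exact IsWCA.mk ⟨hb.1, hb.2, hb.3⟩ h.E_trans h.E_symm h.E_closed

end CylModel

namespace PrimForm

open PrimTerm

/-- In the next formulas, the variables `d`, `d + 1` and `d + 2` stand for the code of a model,
the number of its worlds and the bound for the codes of terms. -/
def rel (d i x y : ℕ) : PrimForm :=
  bit (var d) (pair (const 0) (pair (var i) (pair (var x) (var y))))

def sat (d : ℕ) (a : PrimTerm) (x : ℕ) : PrimForm :=
  bit (var d) (pair (const 1) (pair a (var x)))

def diag (d i j x : ℕ) : PrimForm := sat d (pair (const 3) (pair (var i) (var j))) x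

def ne (i j : ℕ) : PrimForm := not (eq (var i) (var j))

def base (n : ℕ) : PrimForm :=
  and (all (const n) <| all (var 2) <| rel 2 1 0 0) <|
  and (all (const n) <| all (var 2) <| all (var 3) <| imp (rel 3 2 1 0) (rel 3 2 0 1)) <|
  and (all (const n) <| all (var 2) <| all (var 3) <| all (var 4) <|
    imp (rel 4 3 2 1) (imp (rel 4 3 1 0) (rel 4 3 2 0))) <|
  and (all (const n) <| all (var 2) <| diag 2 1 1 0)
    (all (const n) <| all (const n) <| imp (ne 1 0) <| all (var 3) <| all (var 4) <|
      imp (rel 4 3 1 0) <| imp (diag 4 3 2 1) <| imp (diag 4 3 2 0) <| eq (var 1) (var 0))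

def nca (n : ℕ) : PrimForm :=
  all (const n) <| all (const n) <| all (const n) <| imp (ne 0 2) <| imp (ne 0 1) <| all (var 4) <|
    iff (diag 4 3 2 0) <| ex (var 5) <| and (rel 5 2 1 0) <| and (diag 5 4 2 0) (diag 5 2 3 0)

def wca (n : ℕ) : PrimForm :=
  all (const n) <| all (const n) <| all (const n) <| imp (ne 0 2) <| imp (ne 0 1) <|
    and (all (var 4) <| imp (diag 4 3 1 0) <| imp (diag 4 1 2 0) <| diag 4 3 2 0) <|
    and (all (var 4) <| iff (diag 4 3 2 0) (diag 4 2 3 0))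
      (all (var 4) <| all (var 5) <| imp (rel 5 2 1 0) <| imp (diag 5 3 4 1) <| diag 5 3 4 0)

/-- The formula for the frame conditions of `K`. -/
def frame (n : ℕ) : CylClass → PrimForm
  | .NCA => and (base n) (nca n)
  | .WCA => and (base n) (wca n)

/-- The formula that states the inductive clauses for the truth of terms. -/
def truth (n : ℕ) : PrimForm :=
  and (all (var 1) <| not <| sat 1 (const (Nat.pair 1 0)) 0) <|
  and (all (var 1) <| sat 1 (const (Nat.pair 2 0)) 0) <|
  -- The guard `isCodeForm` matters: for a number coding no term, `exists_bits` leaves its bit and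
  -- that of its formal negation both unset, which would violate this clause.
  and (all (var 2) <| imp (isCodeForm n (var 0)) <| imp (le (pair (const 4) (var 0)) (var 3)) <|
    all (var 2) <| iff (sat 2 (pair (const 4) (var 1)) 0) (not <| sat 2 (var 1) 0)) <|
  and (all (const n) <| all (var 3) <| imp (isCodeForm n (var 0)) <|
    imp (le (pair (const 5) (pair (var 1) (var 0))) (var 4)) <|
    all (var 3) <| iff (sat 3 (pair (const 5) (pair (var 2) (var 1))) 0)
      (ex (var 4) <| and (rel 4 3 1 0) (sat 4 (var 2) 0))) <|
  and (all (var 2) <| all (var 3) <| imp (isCodeForm n (var 1)) <| imp (isCodeForm n (var 0)) <|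
    imp (le (pair (const 6) (pair (var 1) (var 0))) (var 4)) <|
    all (var 3) <| iff (sat 3 (pair (const 6) (pair (var 2) (var 1))) 0)
      (and (sat 3 (var 2) 0) (sat 3 (var 1) 0)))
    (all (var 2) <| all (var 3) <| imp (isCodeForm n (var 1)) <| imp (isCodeForm n (var 0)) <|
    imp (le (pair (const 7) (pair (var 1) (var 0))) (var 4)) <|
    all (var 3) <| iff (sat 3 (pair (const 7) (pair (var 2) (var 1))) 0)
      (or (sat 3 (var 2) 0) (sat 3 (var 1) 0)))

theorem base_holds_iff (n M z : ℕ) (l : List ℕ) :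
    (base n).holds (z :: M :: l) ↔ (bitModel n M z).IsBase := by
  change ((∀ i < n, ∀ x < M, bitRel z i x x) ∧
    (∀ i < n, ∀ x < M, ∀ y < M, bitRel z i x y → bitRel z i y x) ∧
    (∀ i < n, ∀ x < M, ∀ y < M, ∀ w < M, bitRel z i x y → bitRel z i y w → bitRel z i x w) ∧
    (∀ i < n, ∀ x < M, bitDiag z i i x) ∧
    (∀ i < n, ∀ j < n, ¬ i = j → ∀ x < M, ∀ y < M, bitRel z i x y → bitDiag z i j x →
      bitDiag z i j y → x = y)) ↔ _
  constructor
  · rintro ⟨h₁, h₂, h₃, h₄, h₅⟩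
    exact
      { equiv := fun i => ⟨fun x => h₁ i i.2 x x.2, fun {x y} => h₂ i i.2 x x.2 y y.2,
          fun {x y w} => h₃ i i.2 x x.2 y y.2 w w.2⟩
        E_self := fun i x => h₄ i i.2 x x.2
        unique := fun i j hij x y h h' h'' => Fin.ext
          (h₅ i i.2 j j.2 (fun h => hij (Fin.ext h)) x x.2 y y.2 h h' h'') }
  · intro h
    exact ⟨fun i hi x hx => (h.equiv ⟨i, hi⟩).refl ⟨x, hx⟩,
      fun i hi x hx y hy => (h.equiv ⟨i, hi⟩).symm (x := ⟨x, hx⟩) (y := ⟨y, hy⟩),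
      fun i hi x hx y hy w hw =>
        (h.equiv ⟨i, hi⟩).trans (x := ⟨x, hx⟩) (y := ⟨y, hy⟩) (z := ⟨w, hw⟩),
      fun i hi x hx => h.E_self ⟨i, hi⟩ ⟨x, hx⟩,
      fun i hi j hj hij x hx y hy h₁ h₂ h₃ => congrArg Fin.val (h.unique ⟨i, hi⟩ ⟨j, hj⟩
        (fun h => hij (congrArg Fin.val h)) ⟨x, hx⟩ ⟨y, hy⟩ h₁ h₂ h₃)⟩

theorem frame_holds_iff (n M z : ℕ) (l : List ℕ) (K : CylClass) :
    (frame n K).holds (z :: M :: l) ↔ (bitModel n M z).InClass K := by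
  have hb := base_holds_iff n M z l
  cases K
  · change ((base n).holds (z :: M :: l) ∧ ∀ i < n, ∀ j < n, ∀ k < n, ¬ k = i → ¬ k = j → ∀ x < M,
      (bitDiag z i j x ↔ ∃ y < M, bitRel z k x y ∧ bitDiag z i k y ∧ bitDiag z k j y)) ↔
      (bitModel n M z).IsNCA
    rw [hb]
    constructor
    · rintro ⟨h₁, h₂⟩
      refine { h₁ with E_iff := fun i j k hki hkj x => (h₂ i i.2 j j.2 k k.2
        (fun h => hki (Fin.ext h)) (fun h => hkj (Fin.ext h)) x x.2).trans ?_ }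
      exact ⟨fun ⟨y, hy, h⟩ => ⟨⟨y, hy⟩, h⟩, fun ⟨y, h⟩ => ⟨y, y.2, h⟩⟩
    · intro h
      refine ⟨h.toIsBase, fun i hi j hj k hk hki hkj x hx => (h.E_iff ⟨i, hi⟩ ⟨j, hj⟩ ⟨k, hk⟩
        (fun h => hki (congrArg Fin.val h)) (fun h => hkj (congrArg Fin.val h)) ⟨x, hx⟩).trans ?_⟩
      exact ⟨fun ⟨y, h⟩ => ⟨y, y.2, h⟩, fun ⟨y, hy, h⟩ => ⟨⟨y, hy⟩, h⟩⟩
  · change ((base n).holds (z :: M :: l) ∧ ∀ i < n, ∀ j < n, ∀ k < n, ¬ k = i → ¬ k = j →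
      (∀ x < M, bitDiag z i k x → bitDiag z k j x → bitDiag z i j x) ∧
      (∀ x < M, bitDiag z i j x ↔ bitDiag z j i x) ∧
      (∀ x < M, ∀ y < M, bitRel z k x y → bitDiag z j i x → bitDiag z j i y)) ↔
      (bitModel n M z).IsWCA
    rw [hb]
    constructor
    · rintro ⟨h₁, h₂⟩
      have h₂ := fun (i j k : Fin n) (hki : k ≠ i) (hkj : k ≠ j) => h₂ i i.2 j j.2 k k.2
        (fun h => hki (Fin.ext h)) (fun h => hkj (Fin.ext h))
      exact { h₁ with
        E_trans := fun i j k hki hkj x => (h₂ i j k hki hkj).1 x x.2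
        E_symm := fun i j k hki hkj x => (h₂ i j k hki hkj).2.1 x x.2
        E_closed := fun i j k hki hkj x y => (h₂ i j k hki hkj).2.2 x x.2 y y.2 }
    · intro h
      refine ⟨h.toIsBase, fun i hi j hj k hk hki hkj => ?_⟩
      have hki : (⟨k, hk⟩ : Fin n) ≠ ⟨i, hi⟩ := fun h => hki (congrArg Fin.val h)
      have hkj : (⟨k, hk⟩ : Fin n) ≠ ⟨j, hj⟩ := fun h => hkj (congrArg Fin.val h)
      exact ⟨fun x hx => h.E_trans _ _ _ hki hkj ⟨x, hx⟩,
        fun x hx => h.E_symm _ _ _ hki hkj ⟨x, hx⟩,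
        fun x hx y hy => h.E_closed _ _ _ hki hkj ⟨x, hx⟩ ⟨y, hy⟩⟩

theorem truth_holds_iff (n c M z : ℕ) (l : List ℕ) :
    (truth n).holds (z :: M :: c :: l) ↔
    (∀ x < M, ¬ bitSat z (Nat.pair 1 0) x) ∧ (∀ x < M, bitSat z (Nat.pair 2 0) x) ∧
    (∀ a < c, IsCode n a → Nat.pair 4 a ≤ c → ∀ x < M,
      (bitSat z (Nat.pair 4 a) x ↔ ¬ bitSat z a x)) ∧
    (∀ i < n, ∀ a < c, IsCode n a → Nat.pair 5 (Nat.pair i a) ≤ c → ∀ x < M,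
      (bitSat z (Nat.pair 5 (Nat.pair i a)) x ↔ ∃ y < M, bitRel z i x y ∧ bitSat z a y)) ∧
    (∀ a < c, ∀ b < c, IsCode n a → IsCode n b → Nat.pair 6 (Nat.pair a b) ≤ c → ∀ x < M,
      (bitSat z (Nat.pair 6 (Nat.pair a b)) x ↔ bitSat z a x ∧ bitSat z b x)) ∧
    (∀ a < c, ∀ b < c, IsCode n a → IsCode n b → Nat.pair 7 (Nat.pair a b) ≤ c → ∀ x < M,
      (bitSat z (Nat.pair 7 (Nat.pair a b)) x ↔ bitSat z a x ∨ bitSat z b x)) := Iff.rfl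

theorem sat_bitModel_iff {n c M z : ℕ} {l : List ℕ}
    (h : (truth n).holds (z :: M :: c :: l)) (s : CylTerm n) (hs : s.code ≤ c) (x : Fin M) :
    (bitModel n M z).Sat s x ↔ bitSat z s.code x := by
  obtain ⟨h₁, h₂, h₃, h₄, h₅, h₆⟩ := (truth_holds_iff n c M z l).1 h
  induction s generalizing x with
  | var k => rfl
  | zero => exact iff_of_false id (h₁ x x.2)
  | one => exact iff_of_true trivial (h₂ x x.2)
  | diag i j => rfl
  | neg s ih =>
    have hlt := s.code_lt_neg.trans_le hs
    exact (not_congr (ih hlt.le x)).trans (h₃ _ hlt ⟨s, rfl⟩ hs x x.2).symm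
  | cyl i s ih =>
    have hlt := (s.code_lt_cyl i).trans_le hs
    refine Iff.trans ?_ (h₄ i i.2 _ hlt ⟨s, rfl⟩ hs x x.2).symm
    constructor
    · rintro ⟨y, hxy, hy⟩
      exact ⟨y, y.2, hxy, (ih hlt.le y).1 hy⟩
    · rintro ⟨y, hyM, hxy, hy⟩
      exact ⟨⟨y, hyM⟩, hxy, (ih hlt.le ⟨y, hyM⟩).2 hy⟩
  | mul s t ih ih' =>
    have hs' := (s.code_lt_mul t).1.trans_le hs
    have ht' := (s.code_lt_mul t).2.trans_le hs
    exact (and_congr (ih hs'.le x) (ih' ht'.le x)).trans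
      (h₅ _ hs' _ ht' ⟨s, rfl⟩ ⟨t, rfl⟩ hs x x.2).symm
  | add s t ih ih' =>
    have hs' := (s.code_lt_add t).1.trans_le hs
    have ht' := (s.code_lt_add t).2.trans_le hs
    exact (or_congr (ih hs'.le x) (ih' ht'.le x)).trans
      (h₆ _ hs' _ ht' ⟨s, rfl⟩ ⟨t, rfl⟩ hs x x.2).symm

end PrimForm

/-- A bound for the positions of the bits that code a model of size at most `L`. -/
def bitBound (L : ℕ) : ℕ := Nat.pair L (Nat.pair L (Nat.pair L L)) + 1

/-- Every finite model is coded by some number. -/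
theorem CylModel.exists_bits {n M c L : ℕ} (H : CylModel n (Fin M)) (hL : 0 < L) (hn : n ≤ L)
    (hM : M ≤ L) (hc : c ≤ L) :
    ∃ z < 2 ^ bitBound L, (∀ (i : Fin n) (x y : Fin M), bitRel z i x y ↔ H.T i x y) ∧
      ∀ (s : CylTerm n) (x : Fin M), s.code ≤ c → (bitSat z s.code x ↔ H.Sat s x) := by
  obtain ⟨z, hz, h⟩ := Nat.exists_testBit_iff (bitBound L) fun b =>
    (∃ (i : Fin n) (x y : Fin M), b = Nat.pair 0 (Nat.pair i (Nat.pair x y)) ∧ H.T i x y) ∨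
    (∃ (s : CylTerm n) (x : Fin M), b = Nat.pair 1 (Nat.pair s.code x) ∧ H.Sat s x)
  refine ⟨z, hz, fun i x y => (h _ ?_).trans ?_, fun s x hs => (h _ ?_).trans ?_⟩
  · exact Nat.lt_succ_of_le (Nat.pair_le_pair (Nat.zero_le _) (Nat.pair_le_pair (i.2.le.trans hn)
      (Nat.pair_le_pair (x.2.le.trans hM) (y.2.le.trans hM))))
  · constructor
    · rintro (⟨i', x', y', heq, hT⟩ | ⟨s', x', heq, -⟩)
      · simp only [Nat.pair_eq_pair, true_and, Fin.val_inj] at heq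
        obtain ⟨rfl, rfl, rfl⟩ := heq
        exact hT
      · simp [Nat.pair_eq_pair] at heq
    · exact fun hT => Or.inl ⟨i, x, y, rfl, hT⟩
  · exact Nat.lt_succ_of_le (Nat.pair_le_pair hL (Nat.pair_le_pair (hs.trans hc)
      ((x.2.le.trans hM).trans (Nat.left_le_pair _ _))))
  · constructor
    · rintro (⟨i', x', y', heq, -⟩ | ⟨s', x', heq, hS⟩)
      · simp [Nat.pair_eq_pair] at heq
      · simp only [Nat.pair_eq_pair, true_and, Fin.val_inj] at heq
        obtain ⟨heq, rfl⟩ := heq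
        rwa [CylTerm.code_injective heq]
    · exact fun hS => Or.inr ⟨s, x, rfl, hS⟩

namespace PrimForm

open PrimTerm

theorem truth_holds_of_forall {n c M z : ℕ} (l : List ℕ) {H : CylModel n (Fin M)}
    (h₁ : Nat.pair 1 0 ≤ c) (h₂ : Nat.pair 2 0 ≤ c)
    (hT : ∀ (i : Fin n) (x y : Fin M), bitRel z i x y ↔ H.T i x y)
    (hS : ∀ (s : CylTerm n) (x : Fin M), s.code ≤ c → (bitSat z s.code x ↔ H.Sat s x)) :
    (truth n).holds (z :: M :: c :: l) := by
  refine (truth_holds_iff n c M z l).2 ⟨fun x hx h => (hS .zero ⟨x, hx⟩ h₁).1 h,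
    fun x hx => (hS .one ⟨x, hx⟩ h₂).2 trivial, ?_, ?_, ?_, ?_⟩
  · rintro _ ha ⟨s, rfl⟩ hc x hx
    exact (hS (.neg s) ⟨x, hx⟩ hc).trans (not_congr (hS s ⟨x, hx⟩ ha.le).symm)
  · rintro i hi _ ha ⟨s, rfl⟩ hc x hx
    refine (hS (.cyl ⟨i, hi⟩ s) ⟨x, hx⟩ hc).trans ⟨?_, ?_⟩
    · rintro ⟨y, hxy, hy⟩
      exact ⟨y, y.2, (hT ⟨i, hi⟩ ⟨x, hx⟩ y).2 hxy, (hS s y ha.le).2 hy⟩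
    · rintro ⟨y, hyM, hxy, hy⟩
      exact ⟨⟨y, hyM⟩, (hT ⟨i, hi⟩ ⟨x, hx⟩ ⟨y, hyM⟩).1 hxy, (hS s ⟨y, hyM⟩ ha.le).1 hy⟩
  · rintro _ ha _ hb ⟨s, rfl⟩ ⟨t, rfl⟩ hc x hx
    exact (hS (.mul s t) ⟨x, hx⟩ hc).trans
      (and_congr (hS s ⟨x, hx⟩ ha.le).symm (hS t ⟨x, hx⟩ hb.le).symm)
  · rintro _ ha _ hb ⟨s, rfl⟩ ⟨t, rfl⟩ hc x hx
    exact (hS (.add s t) ⟨x, hx⟩ hc).trans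
      (or_congr (hS s ⟨x, hx⟩ ha.le).symm (hS t ⟨x, hx⟩ hb.le).symm)

/-- The size bound `CylModel.sizeBound` at the variable `c`. -/
noncomputable def size (n c : ℕ) : PrimTerm :=
  -- Since `n` is fixed, the number of labels is a constant and need not be computed.
  mul (const (Nat.card (Setoid (Fin n)))) (add (mul (add (var c) (const 1))
    (pow (add (mul (const n) (add (var c) (const 1))) (const 1)) (var c))) (const 1))

/-- A bound for the sizes of models, the codes of terms and the dimension. -/
noncomputable def total (n c : ℕ) : PrimTerm :=
  add (add (size n c) (const n)) (add (var c) (const 1))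

/-- The property of `[c, a, b]` that in some model of size at most `sizeBound n c` some world
distinguishes the terms coded by `a` and `b`. -/
noncomputable def refutable (n : ℕ) (K : CylClass) : PrimForm :=
  -- The added one compensates for the strict bound of `ex`.
  ex (add (size n 0) (const 1)) <|
  ex (pow (const 2) (add (pair (total n 1) (pair (total n 1) (pair (total n 1) (total n 1))))
    (const 1))) <|
  and (frame n K) <| and (truth n) <| ex (var 1) <| not <| iff (sat 1 (var 4) 0) (sat 1 (var 5) 0)

theorem refutable_holds_iff (n c a b : ℕ) (K : CylClass) : (refutable n K).holds [c, a, b] ↔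
    ∃ M < CylModel.sizeBound n c + 1,
    ∃ z < 2 ^ bitBound (CylModel.sizeBound n c + n + (c + 1)),
    (frame n K).holds [z, M, c, a, b] ∧ (truth n).holds [z, M, c, a, b] ∧
    ∃ x < M, ¬ (bitSat z a x ↔ bitSat z b x) := Iff.rfl

theorem refutable_holds_code_iff {n c : ℕ} {K : CylClass} {s t : CylTerm n} (hs : s.code ≤ c)
    (ht : t.code ≤ c) (hc : ∀ i j : Fin n, (CylTerm.diag i j).code ≤ c)
    (h₁ : Nat.pair 1 0 ≤ c) (h₂ : Nat.pair 2 0 ≤ c) :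
    (refutable n K).holds [c, s.code, t.code] ↔
      ∃ M ≤ CylModel.sizeBound n c, ∃ (H : CylModel n (Fin M)) (y : Fin M),
        H.InClass K ∧ ¬ (H.Sat s y ↔ H.Sat t y) := by
  rw [refutable_holds_iff]
  constructor
  · rintro ⟨M, hM, z, -, hframe, htruth, x, hx, hst⟩
    refine ⟨M, Nat.le_of_lt_succ hM, bitModel n M z, ⟨x, hx⟩,
      (frame_holds_iff n M z _ K).1 hframe, ?_⟩
    rwa [sat_bitModel_iff htruth s hs, sat_bitModel_iff htruth t ht]
  · rintro ⟨M, hM, H, y, hH, hst⟩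
    obtain ⟨z, hz, hT, hS⟩ := H.exists_bits (c := c)
      (L := CylModel.sizeBound n c + n + (c + 1)) (by omega) (by omega) (by omega) (by omega)
    refine ⟨M, Nat.lt_succ_of_le hM, z, hz, (frame_holds_iff n M z _ K).2 (hH.of_eq ?_ ?_),
      truth_holds_of_forall _ h₁ h₂ hT hS, y, y.2, ?_⟩
    · funext i x y
      exact propext (hT i x y)
    -- Diagonals are read off the truth bits, which are correct because `c` bounds their codes.
    · funext i j x
      exact propext (hS (.diag i j) x (hc i j))
    · rwa [hS s y hs, hS t y ht]

end PrimForm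

theorem CylTerm.exists_forall_code_diag_le (n : ℕ) : ∃ k, Nat.pair 1 0 ≤ k ∧ Nat.pair 2 0 ≤ k ∧
    ∀ i j : Fin n, (CylTerm.diag i j).code ≤ k :=
  ⟨Nat.pair 3 (Nat.pair n n), Nat.pair_le_pair (by norm_num) (Nat.zero_le _),
    Nat.pair_le_pair (by norm_num) (Nat.zero_le _),
    fun i j => Nat.pair_le_pair le_rfl (Nat.pair_le_pair i.2.le j.2.le)⟩

/-! ### Finite model property and decidability -/

namespace CylClass

variable {n : ℕ} {K : CylClass}

/-- An equation fails in some member of `K` if and only if it fails in a finite model whose size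
is bounded in terms of the codes of its sides. -/
theorem exists_eval_ne_iff {s t : CylTerm n} {c : ℕ} (hs : s.code ≤ c) (ht : t.code ≤ c)
    (hc : ∀ i j : Fin n, (CylTerm.diag i j).code ≤ c) :
    (∃ (A : Type u) (_ : BooleanAlgebra A) (C : CylOps n A) (e : ℕ → A),
      K.Mem C ∧ s.eval C e ≠ t.eval C e) ↔
    ∃ M ≤ CylModel.sizeBound n c, ∃ (H : CylModel n (Fin M)) (y : Fin M),
      H.InClass K ∧ ¬ (H.Sat s y ↔ H.Sat t y) := by
  constructor
  · rintro ⟨A, _, C, e, hC, hst⟩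
    obtain ⟨W, F, x, hF, hx⟩ := hC.exists_not_sat_iff e hst
    exact hF.exists_fin_le_sizeBound hx hs ht hc
  · rintro ⟨M, -, H, y, hH, hst⟩
    obtain ⟨A, _, C, e, -, hC, hne⟩ := hH.exists_finite_eval_ne hst
    exact ⟨A, _, C, e, hC, hne⟩

/-- The finite model property. -/
theorem exists_finite_eval_ne {s t : CylTerm n} {A : Type u} [BooleanAlgebra A] {C : CylOps n A}
    (hC : K.Mem C) {e : ℕ → A} (hst : s.eval C e ≠ t.eval C e) :
    ∃ (A : Type v) (_ : BooleanAlgebra A) (C : CylOps n A) (e : ℕ → A),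
      Finite A ∧ K.Mem C ∧ s.eval C e ≠ t.eval C e := by
  obtain ⟨k, -, -, hk⟩ := CylTerm.exists_forall_code_diag_le n
  obtain ⟨M, -, H, y, hH, hne⟩ := (exists_eval_ne_iff (c := s.code + t.code + k) (by omega)
    (by omega) (fun i j => (hk i j).trans (by omega))).1 ⟨A, _, C, e, hC, hst⟩
  exact hH.exists_finite_eval_ne hne

theorem eqTheory_eq_finEqTheory : eqTheory.{u} K n = finEqTheory.{v} K n := by
  ext ⟨s, t⟩
  constructor
  · intro h A _ C _ hC e
    by_contra hne
    obtain ⟨A, _, C, e, -, hC, hne⟩ := exists_finite_eval_ne hC hne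
    exact hne (h A _ C hC e)
  · intro h A _ C hC e
    by_contra hne
    obtain ⟨A, _, C, e, hA, hC, hne⟩ := exists_finite_eval_ne hC hne
    exact hne (h A _ C hA hC e)

theorem mem_eqTheory_iff {s t : CylTerm n} : (s, t) ∈ eqTheory.{u} K n ↔
    ¬ ∃ (A : Type u) (_ : BooleanAlgebra A) (C : CylOps n A) (e : ℕ → A),
      K.Mem C ∧ s.eval C e ≠ t.eval C e := by
  constructor
  · rintro h ⟨A, _, C, e, hC, hne⟩
    exact hne (h A _ C hC e)
  · intro h A _ C hC e
    by_contra hne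
    exact h ⟨A, _, C, e, hC, hne⟩

theorem decidableEquations_eqTheory : DecidableEquations (eqTheory.{u} K n) := by
  obtain ⟨k, h₁, h₂, hk⟩ := CylTerm.exists_forall_code_diag_le n
  have hcode := (isCodeForm n (.var 0)).prim
  -- The sum `p.1 + p.2 + k` bounds both codes and, through the constant `k`, the codes of all
  -- diagonals.
  have hprim : PrimrecPred fun p : ℕ × ℕ => (IsCode n p.1 ∧ IsCode n p.2) ∧
      ¬ (PrimForm.refutable n K).holds [p.1 + p.2 + k, p.1, p.2] := by
    have hl₂ : Primrec fun p : ℕ × ℕ => [p.2] :=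
      Primrec.list_cons.comp Primrec.snd (Primrec.const [])
    have hl₁ : Primrec fun p : ℕ × ℕ => [p.1, p.2] := Primrec.list_cons.comp Primrec.fst hl₂
    have hl₀ : Primrec fun p : ℕ × ℕ => [p.1 + p.2 + k, p.1, p.2] :=
      Primrec.list_cons.comp (Primrec.nat_add.comp
        (Primrec.nat_add.comp Primrec.fst Primrec.snd) (Primrec.const k)) hl₁
    exact ((hcode.comp hl₁).and (hcode.comp hl₂)).and ((PrimForm.refutable n K).prim.comp hl₀).not
  refine (hprim.of_eq fun p => ?_).computablePred
  constructor
  · rintro ⟨⟨⟨s, hs⟩, t, ht⟩, h⟩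
    refine ⟨s, t, hs, ht, mem_eqTheory_iff.2 ?_⟩
    rw [← hs, ← ht] at h
    rwa [exists_eval_ne_iff (c := s.code + t.code + k) (by omega) (by omega)
      (fun i j => (hk i j).trans (by omega)),
      ← PrimForm.refutable_holds_code_iff (by omega) (by omega)
        (fun i j => (hk i j).trans (by omega)) (by omega) (by omega)]
  · rintro ⟨s, t, hs, ht, h⟩
    refine ⟨⟨⟨s, hs⟩, t, ht⟩, ?_⟩
    rw [← hs, ← ht]
    have h := mem_eqTheory_iff.1 h
    rwa [exists_eval_ne_iff (c := s.code + t.code + k) (by omega) (by omega)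
      (fun i j => (hk i j).trans (by omega)),
      ← PrimForm.refutable_holds_code_iff (by omega) (by omega)
        (fun i j => (hk i j).trans (by omega)) (by omega) (by omega)] at h

end CylClass

theorem mainTheorem1 (n : ℕ) (hn : 2 ≤ n) (K : CylClass) :
    (∀ t : CylTerm n,
      (∃ (A : Type u) (_ : BooleanAlgebra A) (C : CylOps n A) (e : ℕ → A),
        K.Mem C ∧ t.eval C e ≠ ⊥) →
      ∃ (A : Type v) (_ : BooleanAlgebra A) (C : CylOps n A) (e : ℕ → A),
        Finite A ∧ K.Mem C ∧ t.eval C e ≠ ⊥) ∧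
    CylClass.eqTheory.{u} K n = CylClass.finEqTheory.{v} K n ∧
    DecidableEquations (CylClass.eqTheory.{u} K n) := by
  refine ⟨?_, CylClass.eqTheory_eq_finEqTheory, CylClass.decidableEquations_eqTheory⟩
  rintro t ⟨A, _, C, e, hC, hne⟩
  -- A nonzero value of `t` is a failure of the equation `t = 0`.
  exact CylClass.exists_finite_eval_ne (t := CylTerm.zero) hC hne
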